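/- **Setting.** Let $m\in(0,4]$. Put $\alpha=\frac1{4-m}$ if $m\in(0,4)$, and $\alpha=b$ with an arbitrary $b>0$ if $m=4$. Let $f:[0,\infty)\to\mathbb R$ be a solution of $$\alpha\,(f-yf_y)+(f^m f_{yyy})_y=0\quad\text{for } y\in(0,\infty),$$ $$f(0)=1,\quad f_y(0)=0,\quad f_{yy}(0)=\kappa,\quad f_{yyy}(0)=0,\qquad \frac{f(y)}{y}\to a\quad\text{as } y\to\infty,$$ for some $\kappa>0$ and some $a>0$ ($f\in C^3([0,\infty))$ with $f^mf_{yyy}$ differentiable on $(0,\infty)$). Let $h$ be the corresponding self-similar solution of the thin-film equation $h_t+(h^mh_{xxx})_x=0$, and let $h_{\rm in}(x)=a|x|$. 1. Let $m\in(0,4)$ and $h(x,t)=t^{\alpha}f\big(|x|/t^{\alpha}\big)$ for $x\in\mathbb R$, $t>0$. Then there exist constants $d_0,D_0>0$ (independent of $t$) such that for all $t>0$ the function $h_x(\cdot,t)^2-h_{{\rm in},x}^2$ is integrable on $\mathbb R$ and $$-t^{\alpha}d_0<\frac12\int_{-\infty}^{\infty}\big(h_x(x,t)^2-h_{{\rm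 in},x}(x)^2\big)\,dx\le -t^{\alpha}D_0 .$$ In particular $h$ has finite positive dissipation: for every $t>0$, $$0<\int_{\mathbb R}h^mh_{xxx}^2\,dx<\infty\quad\text{at time } t,\qquad 0<\int_0^t\int_{\mathbb R}h^mh_{xxx}^2\,dx\,ds<\infty .$$ 2. Let $m=4$ and $h(x,t)=e^{bt}f\big(|x|/e^{bt}\big)$ for $x\in\mathbb R$, $t\in\mathbb R$. Then there exist constants $d_0,D_0>0$ (independent of $t$) such that for all $t\in\mathbb R$ the function $h_x(\cdot,t)^2-h_{{\rm in},x}^2$ is integrable on $\mathbb R$ and $$-e^{bt}d_0<\frac12\int_{-\infty}^{\infty}\big(h_x(x,t)^2-h_{{\rm in},x}(x)^2\big)\,dx\le -e^{bt}D_0 .$$ In particular $h$ has finite positive dissipation: for every $t\in\mathbb R$, $$0<\int_{\mathbb R}h^4h_{xxx}^2\,dx<\infty\quad\text{at time } t,\qquad 0<\int_{-\infty}^t\int_{\mathbb R}h^4h_{xxx}^2\,dx\,ds<\infty .$$ -/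

import Mathlib

open MeasureTheory Set Filter Topology

noncomputable section

/-- The `k`-th derivative of a profile `f : [0,∞) → ℝ` (one-sided at `0`). Only the values of
`f` on `[0,∞)` matter. -/
def profileDeriv (k : ℕ) (f : ℝ → ℝ) (y : ℝ) : ℝ :=
  iteratedDerivWithin k f (Ici 0) y

/-- `f` is a (classical) solution on `[0,∞)` of
`α (f - y f_y) + (f^m f_yyy)_y = 0` for `y ∈ (0,∞)`, with
`f(0) = 1`, `f_y(0) = 0`, `f_yy(0) = κ > 0`, `f_yyy(0) = 0` and
`f(y)/y → a > 0` as `y → ∞`. -/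
structure IsProfile (m α κ a : ℝ) (f : ℝ → ℝ) : Prop where
  contDiffOn : ContDiffOn ℝ 3 f (Ici 0)
  ode : ∀ y : ℝ, 0 < y →
    HasDerivAt (fun s => f s ^ m * profileDeriv 3 f s)
      (-(α * (f y - y * profileDeriv 1 f y))) y
  init_zero : f 0 = 1
  init_one : profileDeriv 1 f 0 = 0
  init_two : profileDeriv 2 f 0 = κ
  kappa_pos : 0 < κ
  init_three : profileDeriv 3 f 0 = 0
  slope_pos : 0 < a
  linear_growth : Tendsto (fun y => f y / y) atTop (𝓝 a)

/-- `h(x,t) = t^α f(|x| / t^α)`, `t > 0`. -/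
def powerSelfSimilar (α : ℝ) (f : ℝ → ℝ) (x t : ℝ) : ℝ :=
  t ^ α * f (|x| / t ^ α)

/-- `h(x,t) = e^{bt} f(|x| / e^{bt})`, `t ∈ ℝ`. -/
def expSelfSimilar (b : ℝ) (f : ℝ → ℝ) (x t : ℝ) : ℝ :=
  Real.exp (b * t) * f (|x| / Real.exp (b * t))

/-- The cone `h_in(x) = a|x|`. -/
def cone (a : ℝ) (x : ℝ) : ℝ := a * |x|

/-- The integrand `h_x(x,t)² - h_{in,x}(x)²`. -/
def energyDensityChange (h : ℝ → ℝ → ℝ) (hin : ℝ → ℝ) (t x : ℝ) : ℝ :=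
  deriv (fun z => h z t) x ^ 2 - deriv hin x ^ 2

/-- The dissipation rate `∫ h^m h_xxx² dx` at time `t`, as a value in `[0,∞]`. -/
def dissipationRate (m : ℝ) (h : ℝ → ℝ → ℝ) (t : ℝ) : ENNReal :=
  ∫⁻ x : ℝ, ENNReal.ofReal (h x t ^ m * iteratedDeriv 3 (fun z => h z t) x ^ 2)

end

/-!
Multiplied by `f''`, the equation is exact: the cumulative energy
`B = α (f f' - y f'² / 2) + f^m f''' f''` satisfies `B' = α / 2 f'² + f^m f'''²`. As long as
`f > 0` both terms are nonnegative, so `B` increases from `0`; this is also why `f` cannot reach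
zero. After subtracting `α / 2 f² / y` one gets a quantity `Q` that is still nondecreasing, and
`Q ≤ 0`: otherwise `f'' f'''` would eventually be positive, `f''` would stay away from zero and `f`
could not grow linearly. Comparing `B` with `α / 2 a² y` therefore gives
`α / 2 ∫₀^y (f'² - a²) + ∫₀^y f^m f'''² ≤ α / 2 (f - a y) (f / y + a)`,
and the energy change is negative as soon as the right-hand side tends to zero.

For this, `f - a y` has to decay. Since `f ~ a y`, in the scaled variables
`P = y^(m/2) f'''`, `U = y^(m/2) f'' / y`, `Z = α (y f' - f) / y` the quantity `Q`, corrected by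
weighted terms, turns into a function `R` for which `R'` and `R / y` are both quadratic forms in
`(P, U, Z)` with convergent coefficients. One choice of the weights makes `R'` coercive and `R`
bounded above along a sequence, whence `P² + U² + Z²` is integrable. Another makes `(y^K R)'`
dominate `y^K (P² + U² + Z²)` for some `K > 1`; hence `y^K Z²` is integrable, and
`(f / y)' = Z / (α y)` yields `f / y - a = O(y^(-q))` with `q > 1`.

The statements on `h` follow by scaling: with the length scale `T` equal to `t^α` or `e^(b t)`, the
energy change is proportional to `T` and the dissipation to `T^(m - 3)`.
-/

/-! ### Real analysis near infinity -/

theorem stronglyMeasurableAtFilter_atTop_of_continuousOn {g : ℝ → ℝ} {b : ℝ}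
    (hg : ContinuousOn g (Ioi b)) : StronglyMeasurableAtFilter g atTop :=
  ⟨Ioi b, Ioi_mem_atTop b, hg.aestronglyMeasurable measurableSet_Ioi⟩

theorem integrableOn_Ioi_of_continuousOn_of_integrableAtFilter {g : ℝ → ℝ} {b : ℝ}
    (hg : ContinuousOn g (Ici b)) (hint : IntegrableAtFilter g atTop) : IntegrableOn g (Ioi b) :=
  (integrableOn_Ici_iff_integrableAtFilter_atTop.2
    ⟨hint, hg.locallyIntegrableOn measurableSet_Ici⟩).mono_set Ioi_subset_Ici_self

theorem tendsto_atTop_of_le_hasDerivAt {g g' : ℝ → ℝ} {c : ℝ} (hc : 0 < c)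
    (hg : ∀ᶠ x in atTop, HasDerivAt g (g' x) x) (hle : ∀ᶠ x in atTop, c ≤ g' x) :
    Tendsto g atTop atTop := by
  obtain ⟨b, hb⟩ := eventually_atTop.1 (hg.and hle)
  have hlin : ∀ x ≥ b, g b + c * (x - b) ≤ g x := fun x hx => by
    have hmvt := (convex_Ici b).mul_sub_le_image_sub_of_le_deriv
      (fun y hy => (hb y hy).1.continuousAt.continuousWithinAt)
      (fun y hy => (hb y (interior_subset hy)).1.differentiableAt.differentiableWithinAt)
      (fun y hy => (hb y (interior_subset hy)).1.deriv ▸ (hb y (interior_subset hy)).2)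
      b self_mem_Ici x hx hx
    linarith
  refine tendsto_atTop_mono' _ (eventually_atTop.2 ⟨b, hlin⟩) ?_
  exact tendsto_atTop_add_const_left _ _
    ((tendsto_atTop_add_const_right _ (-b) tendsto_id).const_mul_atTop hc)

theorem eventually_monotoneOn_Ici_of_hasDerivAt_nonneg {g g' : ℝ → ℝ}
    (hg : ∀ᶠ x in atTop, HasDerivAt g (g' x) x) (hg' : ∀ᶠ x in atTop, 0 ≤ g' x) :
    ∀ᶠ b in atTop, MonotoneOn g (Ici b) := by
  filter_upwards [eventually_forall_ge_atTop.2 hg,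
    eventually_forall_ge_atTop.2 hg'] with b hb hb'
  exact monotoneOn_of_hasDerivWithinAt_nonneg (convex_Ici b)
    (fun x hx => (hb x hx).continuousAt.continuousWithinAt)
    (fun x hx => (hb x (interior_subset hx)).hasDerivWithinAt)
    (fun x hx => hb' x (interior_subset hx))

theorem integrableAtFilter_of_le_hasDerivAt {g g' ψ : ℝ → ℝ} {C : ℝ}
    (hg : ∀ᶠ x in atTop, HasDerivAt g (g' x) x) (hψ : StronglyMeasurableAtFilter ψ atTop)
    (h0 : ∀ᶠ x in atTop, 0 ≤ ψ x) (hle : ∀ᶠ x in atTop, ψ x ≤ g' x)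
    (hC : ∃ᶠ x in atTop, g x ≤ C) : IntegrableAtFilter ψ atTop := by
  have hg' : ∀ᶠ x in atTop, 0 ≤ g' x := h0.mp (hle.mono fun _ h₁ h₂ => h₂.trans h₁)
  obtain ⟨b, hmono, hb⟩ := ((eventually_monotoneOn_Ici_of_hasDerivAt_nonneg hg hg').and
    (eventually_forall_ge_atTop.2 (hg.and hg'))).exists
  have hbound : ∀ x ∈ Ici b, g x ≤ C := fun x hx => by
    obtain ⟨y, hxy, hy⟩ := frequently_atTop.1 hC x
    exact (hmono hx (hx.trans hxy) hxy).trans hy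
  have hlim := tendsto_atTop_ciSup (f := fun x => g (max b x))
    (fun x y hxy => hmono (le_max_left b x) (le_max_left b y) (max_le_max_left _ hxy))
    ⟨C, forall_mem_range.2 fun x => hbound _ (le_max_left b x)⟩
  have hint : IntegrableOn g' (Ioi b) := integrableOn_Ioi_deriv_of_nonneg' (fun x hx => (hb x hx).1)
    (fun x hx => (hb x (le_of_lt hx)).2) (hlim.congr' <| by
      filter_upwards [eventually_ge_atTop b] with x hx
      rw [max_eq_right hx])
  refine Asymptotics.IsBigO.integrableAtFilter (.of_bound 1 ?_) hψ ⟨Ioi b, Ioi_mem_atTop b, hint⟩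
  filter_upwards [h0, hle] with x hx hx'
  rwa [one_mul, Real.norm_of_nonneg hx, Real.norm_of_nonneg (hx.trans hx')]

theorem frequently_lt_div_of_integrableAtFilter {ψ : ℝ → ℝ} {c : ℝ} (hc : 0 < c)
    (hψ : IntegrableAtFilter ψ atTop) : ∃ᶠ y in atTop, ψ y < c / y := by
  intro hnot
  refine (integrableAtFilter_rpow_atTop_iff (s := -1)).not.2 (lt_irrefl _)
    (Asymptotics.IsBigO.integrableAtFilter (.of_bound c⁻¹ ?_) ?_ hψ)
  · filter_upwards [hnot, eventually_gt_atTop 0] with y hy hy0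
    rw [Real.rpow_neg_one, Real.norm_of_nonneg (by positivity), inv_mul_eq_div, le_div_iff₀ hc,
      inv_mul_eq_div]
    exact (not_lt.1 hy).trans (le_abs_self _)
  · exact ⟨univ, univ_mem, by fun_prop⟩

section Lyapunov

variable {R R' N : ℝ → ℝ} {D : ℝ}

theorem frequently_nonpos_of_div_le_integrable
    (hR : ∀ᶠ y in atTop, HasDerivAt R (R' y) y) (hR' : ∀ᶠ y in atTop, 0 ≤ R' y) (hD : 0 < D)
    (hle : ∀ᶠ y in atTop, R y / y ≤ D * N y) (hN : IntegrableAtFilter N atTop) :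
    ∃ᶠ y in atTop, R y ≤ 0 := by
  intro hnot
  obtain ⟨b, hmono, hb⟩ :=
    ((eventually_monotoneOn_Ici_of_hasDerivAt_nonneg hR hR').and hnot).exists
  obtain ⟨y, hNy, hle, hby, hy⟩ := ((frequently_lt_div_of_integrableAtFilter
    (div_pos (not_le.1 hb) hD) hN).and_eventually
      (hle.and ((eventually_ge_atTop b).and (eventually_gt_atTop 0)))).exists
  have hRb : R b / y ≤ R y / y := div_le_div_of_nonneg_right (hmono self_mem_Ici hby hby) hy.le
  have hlt : D * N y < R b / y := by
    calc D * N y < D * (R b / D / y) := mul_lt_mul_of_pos_left hNy hD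
      _ = R b / y := by field_simp
  linarith

theorem integrableAtFilter_rpow_mul_of_lyapunov {ε K : ℝ} (hε : 0 < ε)
    (hR : ∀ᶠ y in atTop, HasDerivAt R (R' y) y) (hN0 : ∀ᶠ y in atTop, 0 ≤ N y)
    (hR' : ∀ᶠ y in atTop, ε * N y ≤ R' y)
    (hRK : ∀ᶠ y in atTop, ε * N y ≤ R' y + K * (R y / y)) (hD : 0 < D)
    (hle : ∀ᶠ y in atTop, R y / y ≤ D * N y) (hN : IntegrableAtFilter N atTop) :
    IntegrableAtFilter (fun y => y ^ K * N y) atTop := by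
  have hpow : ∀ᶠ y in atTop, HasDerivAt (fun y => y ^ K * R y)
      (y ^ K * (R' y + K * (R y / y))) y := by
    filter_upwards [hR, eventually_gt_atTop 0] with y hy hy0
    refine ((Real.hasDerivAt_rpow_const (Or.inl hy0.ne')).mul hy).congr_deriv ?_
    rw [Real.rpow_sub_one hy0.ne']
    ring
  have hmeas : StronglyMeasurableAtFilter (ε • fun y => y ^ K * N y) atTop := by
    obtain ⟨s, hs, hNs⟩ := hN
    exact ⟨s, hs, ((by fun_prop : Measurable fun y : ℝ => y ^ K).aestronglyMeasurable.mul
      hNs.1).const_smul ε⟩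
  have hfreq := frequently_nonpos_of_div_le_integrable hR
    (hR'.mp (hN0.mono fun y hy hy' => (mul_nonneg hε.le hy).trans hy')) hD hle hN
  have hint : IntegrableAtFilter (ε • fun y => y ^ K * N y) atTop := by
    refine integrableAtFilter_of_le_hasDerivAt (C := 0) hpow hmeas ?_ ?_ ?_
    · filter_upwards [hN0, eventually_ge_atTop 0] with y hy hy0
      exact smul_nonneg hε.le (mul_nonneg (Real.rpow_nonneg hy0 K) hy)
    · filter_upwards [hRK, eventually_ge_atTop 0] with y hy hy0
      simpa [mul_left_comm] using mul_le_mul_of_nonneg_left hy (Real.rpow_nonneg hy0 K)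
    · exact (hfreq.and_eventually (eventually_ge_atTop 0)).mono fun y hy =>
        mul_nonpos_of_nonneg_of_nonpos (Real.rpow_nonneg hy.2 K) hy.1
  simpa [smul_smul, inv_mul_cancel₀ hε.ne'] using hint.smul ε⁻¹

end Lyapunov

theorem integrableAtFilter_rpow_mul_of_sq {g : ℝ → ℝ} {K p : ℝ} (hp : 2 * p < K - 1)
    (hg : StronglyMeasurableAtFilter g atTop)
    (hint : IntegrableAtFilter (fun y => y ^ K * g y ^ 2) atTop) :
    IntegrableAtFilter (fun y => y ^ p * g y) atTop := by
  have hpow : IntegrableAtFilter (fun y : ℝ => y ^ (2 * p - K)) atTop :=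
    integrableAtFilter_rpow_atTop_iff.2 (by linarith)
  obtain ⟨s, hs, hgs⟩ := hg
  refine Asymptotics.IsBigO.integrableAtFilter (.of_bound 1 ?_) ⟨s, hs,
    (by fun_prop : Measurable fun y : ℝ => y ^ p).aestronglyMeasurable.mul hgs⟩ (hint.add hpow)
  filter_upwards [eventually_gt_atTop 0] with y hy
  have hKpos : 0 < y ^ K := Real.rpow_pos_of_pos hy K
  -- AM-GM for `q * |g|`, after factoring `y ^ K` out of both sides
  set q := y ^ (p - K)
  have hq₁ : y ^ p = y ^ K * q := by rw [← Real.rpow_add hy]; ring_nf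
  have hq₂ : y ^ (2 * p - K) = y ^ K * q ^ 2 := by
    rw [← Real.rpow_natCast, ← Real.rpow_mul hy.le, ← Real.rpow_add hy]; push_cast; ring_nf
  simp only [Pi.add_apply, one_mul, Real.norm_eq_abs]
  rw [hq₁, hq₂, ← mul_add, abs_of_nonneg (a := y ^ K * _) (by positivity), mul_assoc, abs_mul,
    abs_of_pos hKpos]
  refine mul_le_mul_of_nonneg_left (abs_le.2 ⟨?_, ?_⟩) hKpos.le
  · nlinarith [sq_nonneg (q + g y)]
  · nlinarith [sq_nonneg (q - g y)]

theorem isBigO_sub_rpow_neg_of_integrableAtFilter {g g' : ℝ → ℝ} {l q : ℝ} (hq : 0 ≤ q)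
    (hg : ∀ᶠ y in atTop, HasDerivAt g (g' y) y) (hlim : Tendsto g atTop (𝓝 l))
    (hint : IntegrableAtFilter (fun y => y ^ q * g' y) atTop) :
    (fun y => g y - l) =O[atTop] fun y => y ^ (-q) := by
  obtain ⟨s, hs, hints⟩ := hint
  obtain ⟨b, hb⟩ := mem_atTop_sets.1 hs
  obtain ⟨c, hc⟩ := eventually_atTop.1 (hg.and (eventually_ge_atTop (max b 1)))
  refine .of_bound (∫ y in s, ‖y ^ q * g' y‖) ?_
  filter_upwards [eventually_ge_atTop c] with y hy
  have hy0 : 0 < y := one_pos.trans_le ((le_max_right b 1).trans (hc y hy).2)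
  have hys : Ioi y ⊆ s := fun x hx =>
    hb x ((le_max_left b 1).trans (hc x (hy.trans (le_of_lt hx))).2)
  have hweighted := (hints.mono_set hys).norm.const_mul (y ^ (-q))
  have hpoint : ∀ x ∈ Ioi y, ‖g' x‖ ≤ y ^ (-q) * ‖x ^ q * g' x‖ := fun x hx => by
    rw [norm_mul, Real.norm_of_nonneg (Real.rpow_nonneg (hy0.trans hx).le q), ← mul_assoc,
      Real.rpow_neg hy0.le, inv_mul_eq_div]
    refine le_mul_of_one_le_left (norm_nonneg _) ((one_le_div (Real.rpow_pos_of_pos hy0 q)).2 ?_)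
    exact Real.rpow_le_rpow hy0.le (le_of_lt hx) hq
  have hmeas : AEStronglyMeasurable g' (volume.restrict (Ioi y)) := by
    refine ((by fun_prop : Measurable fun x : ℝ => x ^ (-q)).aestronglyMeasurable.mul
      (hints.mono_set hys).1).congr ?_
    filter_upwards [ae_restrict_mem measurableSet_Ioi] with x hx
    have hx0 : 0 < x := hy0.trans hx
    rw [Pi.mul_apply, ← mul_assoc, ← Real.rpow_add hx0, neg_add_cancel, Real.rpow_zero, one_mul]
  have hg'int : IntegrableOn g' (Ioi y) :=
    hweighted.mono' hmeas ((ae_restrict_mem measurableSet_Ioi).mono hpoint)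
  have hftc : ∫ x in Ioi y, g' x = l - g y := integral_Ioi_of_hasDerivAt_of_tendsto'
    (fun x hx => (hc x (hy.trans hx)).1) hg'int hlim
  rw [norm_sub_rev, ← hftc, Real.norm_of_nonneg (Real.rpow_nonneg hy0.le _), mul_comm]
  calc ‖∫ x in Ioi y, g' x‖ ≤ ∫ x in Ioi y, y ^ (-q) * ‖x ^ q * g' x‖ :=
        norm_integral_le_of_norm_le hweighted
          ((ae_restrict_mem measurableSet_Ioi).mono hpoint)
    _ = y ^ (-q) * ∫ x in Ioi y, ‖x ^ q * g' x‖ := integral_const_mul _ _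
    _ ≤ y ^ (-q) * ∫ x in s, ‖x ^ q * g' x‖ := mul_le_mul_of_nonneg_left
        (setIntegral_mono_set hints.norm (ae_of_all _ fun _ => norm_nonneg _)
          hys.eventuallyLE) (Real.rpow_nonneg hy0.le _)

theorem sq_le_mul_of_mul_hasDerivAt_pos {g g' : ℝ → ℝ} {b y : ℝ}
    (hg : ∀ x ∈ Ici b, HasDerivAt g (g' x) x) (hpos : ∀ x ∈ Ici b, 0 < g x * g' x) (hy : b ≤ y) :
    g b ^ 2 ≤ g b * g y := by
  have hcont : ContinuousOn g (Ici b) := fun x hx => (hg x hx).continuousAt.continuousWithinAt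
  have hsq : MonotoneOn (fun x => g x ^ 2) (Ici b) := by
    refine monotoneOn_of_hasDerivWithinAt_nonneg (convex_Ici b) (hcont.pow 2)
      (fun x hx => ((hg x (interior_subset hx)).pow 2).hasDerivWithinAt) fun x hx => ?_
    have := hpos x (interior_subset hx)
    norm_num
    nlinarith
  have hsame_sign : 0 ≤ g b * g y := by
    by_contra! hneg
    have hzero : (0 : ℝ) ∈ g '' Icc b y := by
      have hivt := intermediate_value_uIcc (hcont.mono (uIcc_of_le hy ▸ Icc_subset_Ici_self))
      rw [uIcc_of_le hy] at hivt
      refine hivt (mem_uIcc.2 ?_)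
      rcases mul_neg_iff.1 hneg with h | h
      · exact Or.inr ⟨h.2.le, h.1.le⟩
      · exact Or.inl ⟨h.1.le, h.2.le⟩
    obtain ⟨x, hx, hgx⟩ := hzero
    simpa [hgx] using hpos x hx.1
  calc g b ^ 2 = |g b| * |g b| := by rw [abs_mul_abs_self, sq]
    _ ≤ |g b| * |g y| :=
        mul_le_mul_of_nonneg_left (sq_le_sq.1 (hsq self_mem_Ici hy hy)) (abs_nonneg _)
    _ = g b * g y := by rw [← abs_mul, abs_of_nonneg hsame_sign]

theorem exists_first_zero {g : ℝ → ℝ} {a y : ℝ} (hay : a ≤ y) (hg : ContinuousOn g (Icc a y))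
    (ha : 0 < g a) (hy : g y ≤ 0) : ∃ b ∈ Ioc a y, g b = 0 ∧ ∀ x ∈ Ico a b, 0 < g x := by
  have hcompact : IsCompact (Icc a y ∩ g ⁻¹' Iic 0) := isCompact_Icc.of_isClosed_subset
    (hg.preimage_isClosed_of_isClosed isClosed_Icc isClosed_Iic) inter_subset_left
  obtain ⟨b, ⟨hb, hgb⟩, hmin⟩ := hcompact.exists_isLeast ⟨y, ⟨hay, le_rfl⟩, hy⟩
  have hab : a < b := hb.1.lt_of_ne (by rintro rfl; exact ha.not_ge hgb)
  refine ⟨b, ⟨hab, hb.2⟩, ?_, fun x hx => ?_⟩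
  · obtain ⟨x, hx, hgx⟩ :=
      intermediate_value_Icc' hb.1 (hg.mono (Icc_subset_Icc_right hb.2)) ⟨hgb, ha.le⟩
    rwa [(hmin ⟨⟨hx.1, hx.2.trans hb.2⟩, hgx.le⟩).antisymm hx.2]
  · by_contra! hgx
    exact hx.2.not_ge (hmin ⟨⟨hx.1, hx.2.le.trans hb.2⟩, hgx⟩)

theorem rpow_eq_rpow_half_sq {y : ℝ} (hy : 0 ≤ y) (m : ℝ) : y ^ m = (y ^ (m / 2)) ^ 2 := by
  rw [← Real.rpow_natCast, ← Real.rpow_mul hy]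
  norm_num

theorem hasDerivAt_rpow_div {y : ℝ} (hy : 0 < y) (m : ℝ) :
    HasDerivAt (fun s : ℝ => s ^ m) (m * y ^ m / y) y := by
  refine (Real.hasDerivAt_rpow_const (Or.inl hy.ne')).congr_deriv ?_
  rw [Real.rpow_sub_one hy.ne', mul_div_assoc]

theorem abs_add_sq_sub_sq_le {a u : ℝ} (ha : 0 ≤ a) (hu : u ∈ Icc 0 (2 * a)) (v : ℝ) :
    |(u + v) ^ 2 - a ^ 2| ≤ 3 * a * |u - a| + 4 * a * |v| + v ^ 2 := by
  have hfirst : |(u + a) * (u - a)| ≤ 3 * a * |u - a| := by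
    rw [abs_mul, abs_of_nonneg (add_nonneg hu.1 ha)]
    gcongr
    linarith [hu.2]
  have hsecond : |2 * u * v| ≤ 4 * a * |v| := by
    rw [abs_mul, abs_of_nonneg (mul_nonneg zero_le_two hu.1)]
    exact mul_le_mul_of_nonneg_right (by linarith [hu.2]) (abs_nonneg v)
  calc |(u + v) ^ 2 - a ^ 2| = |(u + a) * (u - a) + 2 * u * v + v ^ 2| := by ring_nf
    _ ≤ |(u + a) * (u - a)| + |2 * u * v| + |v ^ 2| := abs_add_three _ _ _
    _ ≤ 3 * a * |u - a| + 4 * a * |v| + v ^ 2 := by rw [abs_of_nonneg (sq_nonneg v)]; gcongr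

/-! ### Energies of a profile -/

/-- The flux `f ^ m * f'''` of a profile. -/
noncomputable def profileFlux (m : ℝ) (f : ℝ → ℝ) (y : ℝ) : ℝ := f y ^ m * profileDeriv 3 f y

/-- The derivative of the flux of a profile, as prescribed by the equation. It is meaningful at `0`
too, where its value is `-α`. -/
noncomputable def profileFluxDeriv (α : ℝ) (f : ℝ → ℝ) (y : ℝ) : ℝ :=
  -(α * (f y - y * profileDeriv 1 f y))

/-- The density of dissipation `f ^ m * f''' ^ 2` of a profile. -/
noncomputable def profileDissipation (m : ℝ) (f : ℝ → ℝ) (y : ℝ) : ℝ :=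
  f y ^ m * profileDeriv 3 f y ^ 2

/-- The primitive, vanishing at `0`, of `α / 2 * f' ^ 2 + f ^ m * f''' ^ 2`: the equation multiplied
by `f''` is exact. -/
noncomputable def cumulativeEnergy (m α : ℝ) (f : ℝ → ℝ) (y : ℝ) : ℝ :=
  α * (f y * profileDeriv 1 f y - y * profileDeriv 1 f y ^ 2 / 2)
    + profileFlux m f y * profileDeriv 2 f y

/-- The cumulative energy minus `α / 2 * f ^ 2 / y`, written through the flux. Subtracting this
term removes the linear growth of the cumulative energy but keeps its derivative nonnegative. -/
noncomputable def reducedEnergy (m α : ℝ) (f : ℝ → ℝ) (y : ℝ) : ℝ :=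
  profileFlux m f y * profileDeriv 2 f y - profileFluxDeriv α f y ^ 2 / (2 * α * y)

theorem reducedEnergy_eq_cumulativeEnergy_sub {m α : ℝ} {f : ℝ → ℝ} {y : ℝ} (hy : y ≠ 0) :
    reducedEnergy m α f y = cumulativeEnergy m α f y - α / 2 * f y ^ 2 / y := by
  rw [reducedEnergy, cumulativeEnergy, profileFluxDeriv]
  field_simp
  ring

namespace IsProfile

variable {m α κ a : ℝ} {f : ℝ → ℝ}

theorem continuousOn_profileDeriv (h : IsProfile m α κ a f) {k : ℕ} (hk : k ≤ 3) :
    ContinuousOn (profileDeriv k f) (Ici 0) :=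
  h.contDiffOn.continuousOn_iteratedDerivWithin (by exact_mod_cast hk) (uniqueDiffOn_Ici 0)

theorem hasDerivAt_profileDeriv (h : IsProfile m α κ a f) {k : ℕ} (hk : k < 3) {y : ℝ}
    (hy : 0 < y) : HasDerivAt (profileDeriv k f) (profileDeriv (k + 1) f y) y := by
  have hwithin := (h.contDiffOn.differentiableOn_iteratedDerivWithin (m := k)
    (by exact_mod_cast hk) (uniqueDiffOn_Ici 0) y hy.le).hasDerivWithinAt
  rw [← iteratedDerivWithin_succ] at hwithin
  exact hwithin.hasDerivAt (Ici_mem_nhds hy)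

theorem hasDerivAt (h : IsProfile m α κ a f) {y : ℝ} (hy : 0 < y) :
    HasDerivAt f (profileDeriv 1 f y) y := by
  have hzero : profileDeriv 0 f = f := iteratedDerivWithin_zero
  simpa only [hzero] using h.hasDerivAt_profileDeriv (k := 0) (by norm_num) hy

theorem continuousOn_profileFlux (h : IsProfile m α κ a f) (hm : 0 < m) :
    ContinuousOn (profileFlux m f) (Ici 0) :=
  (h.contDiffOn.continuousOn.rpow_const fun _ _ => Or.inr hm.le).mul
    (h.continuousOn_profileDeriv le_rfl)

theorem hasDerivAt_profileFlux (h : IsProfile m α κ a f) {y : ℝ} (hy : 0 < y) :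
    HasDerivAt (profileFlux m f) (profileFluxDeriv α f y) y :=
  h.ode y hy

theorem continuousOn_profileFluxDeriv (h : IsProfile m α κ a f) :
    ContinuousOn (profileFluxDeriv α f) (Ici 0) :=
  ((h.contDiffOn.continuousOn.sub
    (continuousOn_id.mul (h.continuousOn_profileDeriv (by norm_num)))).const_smul α).neg

theorem hasDerivAt_profileFluxDeriv (h : IsProfile m α κ a f) {y : ℝ} (hy : 0 < y) :
    HasDerivAt (profileFluxDeriv α f) (α * y * profileDeriv 2 f y) y := by
  refine (((h.hasDerivAt hy).sub ((hasDerivAt_id y).mul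
    (h.hasDerivAt_profileDeriv (by norm_num) hy))).const_mul α).neg.congr_deriv ?_
  simp only [id]
  ring

theorem continuousOn_profileDissipation (h : IsProfile m α κ a f) (hm : 0 < m) :
    ContinuousOn (profileDissipation m f) (Ici 0) :=
  (h.contDiffOn.continuousOn.rpow_const fun _ _ => Or.inr hm.le).mul
    ((h.continuousOn_profileDeriv le_rfl).pow 2)

theorem continuousOn_cumulativeEnergy (h : IsProfile m α κ a f) (hm : 0 < m) :
    ContinuousOn (cumulativeEnergy m α f) (Ici 0) := by
  have hf₁ := h.continuousOn_profileDeriv (k := 1) (by norm_num)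
  exact (((h.contDiffOn.continuousOn.mul hf₁).sub
    ((continuousOn_id.mul (hf₁.pow 2)).div_const 2)).const_smul α).add
      ((h.continuousOn_profileFlux hm).mul (h.continuousOn_profileDeriv (by norm_num)))

theorem hasDerivAt_cumulativeEnergy (h : IsProfile m α κ a f) {y : ℝ} (hy : 0 < y) :
    HasDerivAt (cumulativeEnergy m α f)
      (α / 2 * profileDeriv 1 f y ^ 2 + profileDissipation m f y) y := by
  have hf₁ := h.hasDerivAt_profileDeriv (k := 1) (by norm_num) hy
  refine (((((h.hasDerivAt hy).mul hf₁).sub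
    (((hasDerivAt_id y).mul (hf₁.pow 2)).div_const 2)).const_mul α).add
      ((h.hasDerivAt_profileFlux hy).mul
        (h.hasDerivAt_profileDeriv (by norm_num) hy))).congr_deriv ?_
  simp only [id, Pi.pow_apply, profileFlux, profileFluxDeriv, profileDissipation]
  push_cast
  ring

theorem cumulativeEnergy_zero (h : IsProfile m α κ a f) : cumulativeEnergy m α f 0 = 0 := by
  simp [cumulativeEnergy, profileFlux, h.init_one, h.init_three]

/-- At a first zero of the profile the cumulative energy would be nonpositive, hence it would vanish
identically up to there, although `f'` cannot. -/
theorem pos (h : IsProfile m α κ a f) (hm : 0 < m) (hα : 0 < α) {y : ℝ} (hy : 0 ≤ y) :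
    0 < f y := by
  by_contra! hfy
  obtain ⟨b, hb, hfb, hpos⟩ := exists_first_zero hy
    (h.contDiffOn.continuousOn.mono Icc_subset_Ici_self) (h.init_zero ▸ one_pos) hfy
  have hdiss : ∀ x ∈ Ioo 0 b, 0 ≤ profileDissipation m f x := fun x hx =>
    mul_nonneg (Real.rpow_nonneg (hpos x ⟨hx.1.le, hx.2⟩).le m) (sq_nonneg _)
  have hmono : MonotoneOn (cumulativeEnergy m α f) (Icc 0 b) := by
    refine monotoneOn_of_hasDerivWithinAt_nonneg (convex_Icc 0 b)
      (f' := fun x => α / 2 * profileDeriv 1 f x ^ 2 + profileDissipation m f x)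
      ((h.continuousOn_cumulativeEnergy hm).mono Icc_subset_Ici_self) (fun x hx => ?_)
      fun x hx => ?_
    · exact (h.hasDerivAt_cumulativeEnergy (interior_Icc (a := (0 : ℝ)) ▸ hx).1).hasDerivWithinAt
    · have := hdiss x (interior_Icc (a := (0 : ℝ)) ▸ hx)
      positivity
  have hend : cumulativeEnergy m α f b ≤ 0 := by
    have : 0 ≤ α * (b * profileDeriv 1 f b ^ 2 / 2) := by have := hb.1; positivity
    simp only [cumulativeEnergy, profileFlux, hfb, Real.zero_rpow hm.ne']
    linarith
  have hzero : ∀ x ∈ Icc 0 b, cumulativeEnergy m α f x = 0 := fun x hx =>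
    ((hmono hx (right_mem_Icc.2 hb.1.le) hx.2).trans hend).antisymm
      (h.cumulativeEnergy_zero ▸ hmono (left_mem_Icc.2 hb.1.le) hx hx.1)
  obtain ⟨x, hx, hslope⟩ := exists_hasDerivAt_eq_slope f (profileDeriv 1 f) hb.1
    (h.contDiffOn.continuousOn.mono Icc_subset_Ici_self) fun x hx => h.hasDerivAt hx.1
  have hf₁ : profileDeriv 1 f x ≠ 0 := by
    rw [hslope, hfb, h.init_zero]
    exact div_ne_zero (by norm_num) (by linarith [hb.1])
  have hderiv := (h.hasDerivAt_cumulativeEnergy hx.1).unique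
    ((hasDerivAt_const x (0 : ℝ)).congr_of_eventuallyEq <| by
      filter_upwards [Ioo_mem_nhds hx.1 hx.2] with s hs using hzero s (Ioo_subset_Icc_self hs))
  have : 0 < α / 2 * profileDeriv 1 f x ^ 2 := by positivity
  linarith [hdiss x hx]

theorem profileDissipation_nonneg (h : IsProfile m α κ a f) (hm : 0 < m) (hα : 0 < α) {y : ℝ}
    (hy : 0 ≤ y) : 0 ≤ profileDissipation m f y :=
  mul_nonneg (Real.rpow_nonneg (h.pos hm hα hy).le m) (sq_nonneg _)

theorem hasDerivAt_reducedEnergy (h : IsProfile m α κ a f) (hα : 0 < α) {y : ℝ} (hy : 0 < y) :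
    HasDerivAt (reducedEnergy m α f)
      (profileDissipation m f y + profileFluxDeriv α f y ^ 2 / (2 * α * y ^ 2)) y := by
  have hsq := ((h.hasDerivAt_profileFluxDeriv hy).pow 2).div
    ((hasDerivAt_id y).const_mul (2 * α)) (by simp only [id]; positivity)
  refine (((h.hasDerivAt_profileFlux hy).mul
    (h.hasDerivAt_profileDeriv (k := 2) (by norm_num) hy)).sub hsq).congr_deriv ?_
  simp only [id, Pi.pow_apply, profileFlux, profileDissipation]
  field_simp
  push_cast
  ring

theorem reducedEnergy_deriv_nonneg (h : IsProfile m α κ a f) (hm : 0 < m) (hα : 0 < α) {y : ℝ}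
    (hy : 0 ≤ y) :
    0 ≤ profileDissipation m f y + profileFluxDeriv α f y ^ 2 / (2 * α * y ^ 2) := by
  have := h.profileDissipation_nonneg hm hα hy
  positivity

theorem not_eventually_le_mul_profileDeriv_two (h : IsProfile m α κ a f) {s c : ℝ} (hc : 0 < c) :
    ¬ ∀ᶠ y in atTop, c ≤ s * profileDeriv 2 f y := by
  intro hconvex
  have hf₁ : Tendsto (fun y => s * profileDeriv 1 f y) atTop atTop :=
    tendsto_atTop_of_le_hasDerivAt hc (by
      filter_upwards [eventually_gt_atTop 0] with y hy
      exact (h.hasDerivAt_profileDeriv (by norm_num) hy).const_mul s) hconvex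
  have hf : Tendsto (fun y => s * f y - (s * a + 1) * y) atTop atTop :=
    tendsto_atTop_of_le_hasDerivAt one_pos (by
      filter_upwards [eventually_gt_atTop 0] with y hy
      exact ((h.hasDerivAt hy).const_mul s).sub ((hasDerivAt_id y).const_mul (s * a + 1))) (by
      filter_upwards [hf₁.eventually_ge_atTop (s * a + 2)] with y hy
      linarith)
  refine (ge_of_tendsto (h.linear_growth.const_mul s) (b := s * a + 1) ?_).not_gt (by linarith)
  filter_upwards [hf.eventually_ge_atTop 0, eventually_gt_atTop 0] with y hy hy0
  rw [← mul_div_assoc, le_div_iff₀ hy0]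
  linarith

/-- If `f'' * f'''` is eventually positive, then `f''` stays away from zero. -/
theorem frequently_reducedEnergy_nonpos (h : IsProfile m α κ a f) (hm : 0 < m) (hα : 0 < α) :
    ∃ᶠ y in atTop, reducedEnergy m α f y ≤ 0 := by
  intro hnot
  have hsign : ∀ᶠ y in atTop, 0 < profileDeriv 2 f y * profileDeriv 3 f y := by
    filter_upwards [hnot, eventually_gt_atTop 0] with y hy hy0
    have hsq : 0 ≤ profileFluxDeriv α f y ^ 2 / (2 * α * y) := by positivity
    have hprod : 0 < f y ^ m * (profileDeriv 2 f y * profileDeriv 3 f y) := by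
      simp only [reducedEnergy, profileFlux] at hy
      linarith
    exact (mul_pos_iff_of_pos_left (Real.rpow_pos_of_pos (h.pos hm hα hy0.le) m)).1 hprod
  obtain ⟨b, hb, hb0⟩ :=
    ((eventually_forall_ge_atTop.2 hsign).and (eventually_gt_atTop 0)).exists
  refine h.not_eventually_le_mul_profileDeriv_two (s := profileDeriv 2 f b)
    (sq_pos_of_ne_zero (left_ne_zero_of_mul (hb b le_rfl).ne')) ?_
  filter_upwards [eventually_ge_atTop b] with y hy
  exact sq_le_mul_of_mul_hasDerivAt_pos
    (fun x hx => h.hasDerivAt_profileDeriv (by norm_num) (hb0.trans_le hx)) hb hy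

theorem reducedEnergy_nonpos (h : IsProfile m α κ a f) (hm : 0 < m) (hα : 0 < α) {y : ℝ}
    (hy : 0 < y) : reducedEnergy m α f y ≤ 0 := by
  have hmono : MonotoneOn (reducedEnergy m α f) (Ici y) :=
    monotoneOn_of_hasDerivWithinAt_nonneg (convex_Ici y)
      (fun x hx => (h.hasDerivAt_reducedEnergy hα
        (hy.trans_le hx)).continuousAt.continuousWithinAt)
      (fun x hx => (h.hasDerivAt_reducedEnergy hα
        (hy.trans_le (interior_subset hx))).hasDerivWithinAt)
      fun x hx => h.reducedEnergy_deriv_nonneg hm hα (hy.le.trans (interior_subset hx))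
  obtain ⟨x, hyx, hx⟩ := frequently_atTop.1 (h.frequently_reducedEnergy_nonpos hm hα) y
  exact (hmono self_mem_Ici hyx hyx).trans hx

end IsProfile

/-! ### Quadratic forms -/

/-- The quadratic form `R y / y` for the weighted energy `R` with weights `θ`, `c`, `e`, in terms of
the scaled variables `P`, `U`, `Z` and the coefficients `H`, `σ`. -/
noncomputable def energyForm (α θ c e H σ P U Z : ℝ) : ℝ :=
  H * (P * U) - Z ^ 2 / (2 * α) + θ * U ^ 2 + c * (H * σ * (Z * P)) + e * (σ * (U * Z))

/-- The quadratic form `R' y` for the weighted energy `R` with weights `θ`, `c`, `e`, in terms of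
the scaled variables `P`, `U`, `Z` and the coefficients `H`, `σ`. -/
noncomputable def energyRateForm (m α θ c e H σ P U Z : ℝ) : ℝ :=
  H * P ^ 2 + Z ^ 2 / (2 * α) + θ * ((m - 1) * U ^ 2 + 2 * (P * U))
    + c * (Z ^ 2 + α * (H * (P * U)) - 2 * (H * σ * (Z * P)))
    + e * ((m - 3) * (σ * (U * Z)) + σ * (Z * P) + α * U ^ 2)

theorem quadratic_form_nonneg {p d q : ℝ} (hp : 0 < p) (hd : d ^ 2 ≤ 4 * p * q) (x y : ℝ) :
    0 ≤ p * x ^ 2 + d * (x * y) + q * y ^ 2 := by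
  have : 0 ≤ (4 * p * q - d ^ 2) * y ^ 2 := mul_nonneg (sub_nonneg.2 hd) (sq_nonneg y)
  nlinarith [sq_nonneg (2 * p * x + d * y)]

theorem abs_mul_mul_le_of_abs_le {d D : ℝ} (hd : |d| ≤ D) (x y : ℝ) :
    |d * (x * y)| ≤ D * ((x ^ 2 + y ^ 2) / 2) := by
  rw [abs_mul]
  refine mul_le_mul hd (abs_le.2 ⟨?_, ?_⟩) (abs_nonneg _) ((abs_nonneg _).trans hd)
  · nlinarith [sq_nonneg (x + y)]
  · nlinarith [sq_nonneg (x - y)]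

theorem energyForm_le {α θ c e A H σ : ℝ} (hα : 0 < α) (hH : H ∈ Icc 0 (2 * A))
    (hσ : σ ∈ Icc 0 1) (P U Z : ℝ) :
    energyForm α θ c e H σ P U Z ≤ (A + |θ| + |c| * A + |e|) * (P ^ 2 + U ^ 2 + Z ^ 2) := by
  have hHA : |H| ≤ 2 * A := (abs_of_nonneg hH.1).trans_le hH.2
  have hPU := le_of_abs_le (abs_mul_mul_le_of_abs_le hHA P U)
  have hc : |c * (H * σ)| ≤ |c| * (2 * A) := by
    rw [abs_mul, abs_of_nonneg (mul_nonneg hH.1 hσ.1)]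
    exact mul_le_mul_of_nonneg_left ((mul_le_of_le_one_right hH.1 hσ.2).trans hH.2) (abs_nonneg c)
  have hZP := le_of_abs_le (abs_mul_mul_le_of_abs_le hc Z P)
  have he : |e * σ| ≤ |e| := by
    rw [abs_mul, abs_of_nonneg hσ.1]
    exact mul_le_of_le_one_right (abs_nonneg e) hσ.2
  have hUZ := le_of_abs_le (abs_mul_mul_le_of_abs_le he U Z)
  have hA : 0 ≤ A := by linarith [hH.1, hH.2]
  have hθ := mul_le_mul_of_nonneg_right (le_abs_self θ) (sq_nonneg U)
  have : 0 ≤ Z ^ 2 / (2 * α) := by positivity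
  have : 0 ≤ A * Z ^ 2 + |θ| * (P ^ 2 + Z ^ 2) + |c| * A * U ^ 2
      + |e| * (P ^ 2 + U ^ 2 / 2 + Z ^ 2 / 2) := by positivity
  rw [energyForm]
  linarith

theorem energyRateForm_coercive {m α A e H σ : ℝ} (hm : 0 ≤ m) (hm4 : m ≤ 4) (hα : 0 < α)
    (he : 0 < e) (heA : e ≤ A / 2) (heα : e * (18 + 2 * α) ≤ 1) (hH : A / 2 ≤ H)
    (hσ : σ ∈ Icc 0 1) (P U Z : ℝ) :
    min (A / 4) (min (e * α / 2) (1 / (4 * α))) * (P ^ 2 + U ^ 2 + Z ^ 2)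
      ≤ energyRateForm m α 0 0 e H σ P U Z := by
  set ε := min (A / 4) (min (e * α / 2) (1 / (4 * α)))
  have hεP : ε * P ^ 2 ≤ A / 4 * P ^ 2 := by gcongr; exact min_le_left _ _
  have hεU : ε * U ^ 2 ≤ e * α / 2 * U ^ 2 := by
    gcongr; exact (min_le_right _ _).trans (min_le_left _ _)
  have hεZ : ε * Z ^ 2 ≤ 1 / (4 * α) * Z ^ 2 := by
    gcongr; exact (min_le_right _ _).trans (min_le_right _ _)
  have hPZ : 0 ≤ A / 4 * P ^ 2 + e * σ * (P * Z) + e / 2 * Z ^ 2 := by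
    refine quadratic_form_nonneg (by linarith) ?_ P Z
    have : (e * σ) ^ 2 ≤ e ^ 2 := by
      gcongr; exacts [mul_nonneg he.le hσ.1, mul_le_of_le_one_right he.le hσ.2]
    nlinarith
  have hUZ : 0 ≤ e * α / 2 * U ^ 2 + e * (m - 3) * σ * (U * Z) + 9 * e / (2 * α) * Z ^ 2 := by
    refine quadratic_form_nonneg (by positivity) ?_ U Z
    have hsq : ((m - 3) * σ) ^ 2 ≤ 3 ^ 2 := by
      refine sq_le_sq' ?_ ?_ <;> nlinarith [hσ.1, hσ.2]
    calc (e * (m - 3) * σ) ^ 2 = e ^ 2 * ((m - 3) * σ) ^ 2 := by ring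
      _ ≤ e ^ 2 * 3 ^ 2 := by gcongr
      _ = 4 * (e * α / 2) * (9 * e / (2 * α)) := by field_simp; ring
  have hHP : A / 2 * P ^ 2 ≤ H * P ^ 2 := by gcongr
  have hZcoeff : 9 * e / (2 * α) * Z ^ 2 + e / 2 * Z ^ 2 ≤ 1 / (4 * α) * Z ^ 2 := by
    rw [← add_mul]
    gcongr
    rw [div_add_div _ _ (by positivity) two_ne_zero,
      div_le_div_iff₀ (by positivity) (by positivity)]
    nlinarith
  have hZ : Z ^ 2 / (2 * α) = 2 * (1 / (4 * α) * Z ^ 2) := by field_simp; ring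
  rw [energyRateForm, hZ]
  linarith

theorem coercive_PU_part_of_eq_four {α A c k H : ℝ} (hα : 0 < α) (hA : 0 < A) (hc : 0 < c)
    (hcα : α * c ≤ 1 / 100) (hk : k ∈ Icc 0 (1 + α * c))
    (hH : H ∈ Icc (99 / 100 * A) (101 / 100 * A)) (P U : ℝ) :
    141 / 1000 * A * P ^ 2 + A / 10 * U ^ 2
      ≤ H * P ^ 2 + (2 * A + k * H + α * c * H) * (P * U) + (3 + k) * A * U ^ 2 := by
  have hH0 : 0 < H := by linarith [hH.1]
  have hkH : k * H ≤ k * A + 2 / 100 * A := by nlinarith [hk.1, hk.2, hH.2]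
  have hcH : α * c * H ≤ 2 / 100 * A := by nlinarith [hH.2]
  have hkA : k * A ≤ 101 / 100 * A := by gcongr; linarith [hk.2]
  set B := 2 * A + k * H + α * c * H
  have hB0 : 0 < B := by have := hk.1; positivity
  have hPU : 0 ≤ B / 4 * P ^ 2 + B * (P * U) + B * U ^ 2 :=
    quadratic_form_nonneg (by positivity) (by linarith) P U
  have hBP : B / 4 * P ^ 2 ≤ 77 / 100 * A * P ^ 2 := by gcongr; linarith
  have hBU : B * U ^ 2 ≤ (2 * A + k * A + 4 / 100 * A) * U ^ 2 := by gcongr; linarith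
  have hHP : 99 / 100 * A * P ^ 2 ≤ H * P ^ 2 := by gcongr; exact hH.1
  have : 0 ≤ A * P ^ 2 := by positivity
  have : 0 ≤ A * U ^ 2 := by positivity
  linarith

theorem coercive_ZP_part_of_eq_four {A c k H : ℝ} (hA : 0 < A) (hc : 0 < c)
    (hcA : A * c ≤ 1 / 100) (hk : k ∈ Icc 0 (101 / 100))
    (hH : H ∈ Icc (99 / 100 * A) (101 / 100 * A)) (Z P : ℝ) :
    0 ≤ c / 4 * Z ^ 2 + c * (k - 2) * H * (Z * P) + 41 / 1000 * A * P ^ 2 := by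
  refine quadratic_form_nonneg (by positivity) ?_ Z P
  have hsq : ((k - 2) * H) ^ 2 ≤ (202 / 100 * A) ^ 2 := by
    refine sq_le_sq' ?_ ?_ <;> nlinarith [hk.1, hk.2, hH.1, hH.2]
  calc (c * (k - 2) * H) ^ 2 = c ^ 2 * ((k - 2) * H) ^ 2 := by ring
    _ ≤ c ^ 2 * (202 / 100 * A) ^ 2 := by gcongr
    _ = (202 / 100) ^ 2 * (A * c) * (c * A) := by ring
    _ ≤ (202 / 100) ^ 2 * (1 / 100) * (c * A) := by gcongr
    _ ≤ 4 * (c / 4) * (41 / 1000 * A) := by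
      have : 0 < c * A := by positivity
      linarith

theorem energyRateForm_add_mul_energyForm_coercive_of_eq_four {α A c k H : ℝ} (hα : 0 < α)
    (hA : 0 < A) (hc : 0 < c) (hcα : α * c ≤ 1 / 100) (hcA : A * c ≤ 1 / 100)
    (hk : k ∈ Icc 0 (1 + α * c)) (hH : H ∈ Icc (99 / 100 * A) (101 / 100 * A)) (P U Z : ℝ) :
    min (A / 10) (c / 4) * (P ^ 2 + U ^ 2 + Z ^ 2)
      ≤ energyRateForm 4 α A c 0 H 1 P U Z + k * energyForm α A c 0 H 1 P U Z := by
  have hε : min (A / 10) (c / 4) * (P ^ 2 + U ^ 2 + Z ^ 2)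
      ≤ A / 10 * P ^ 2 + A / 10 * U ^ 2 + c / 4 * Z ^ 2 := by
    rw [mul_add, mul_add]
    gcongr
    exacts [min_le_left _ _, min_le_left _ _, min_le_right _ _]
  have hPU := coercive_PU_part_of_eq_four hα hA hc hcα hk hH P U
  have hZP := coercive_ZP_part_of_eq_four hA hc hcA ⟨hk.1, by linarith [hk.2]⟩ hH Z P
  have hZ : c / 2 * Z ^ 2 ≤ ((1 - k) / (2 * α) + c) * Z ^ 2 := by
    gcongr
    have : -(c / 2) ≤ (1 - k) / (2 * α) := by
      rw [le_div_iff₀ (by positivity)]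
      linarith [hk.2]
    linarith
  calc _ ≤ _ := hε
    _ ≤ H * P ^ 2 + (2 * A + k * H + α * c * H) * (P * U) + (3 + k) * A * U ^ 2
        + ((1 - k) / (2 * α) + c) * Z ^ 2 + c * (k - 2) * H * (Z * P) := by linarith
    _ = _ := by rw [energyRateForm, energyForm]; ring

theorem abs_div_mul_le_of_abs_le {σ α x b ε : ℝ} (hσ : 0 ≤ σ) (hα : 0 < α) (hx : |x| ≤ b)
    (hε : σ * (b / α) ≤ ε) : |σ / α * x| ≤ ε := by
  rw [abs_mul, abs_of_nonneg (by positivity)]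
  calc σ / α * |x| ≤ σ / α * b := by gcongr
    _ = σ * (b / α) := by ring
    _ ≤ ε := hε

theorem energyRateForm_add_mul_energyForm_coercive_of_small_coupling {m α A k H σ : ℝ} (hm : 0 ≤ m)
    (hm4 : m ≤ 4) (hα : 0 < α) (hA : 0 < A) (hk : k ∈ Icc 0 2) (hH : H ∈ Icc (A / 2) (2 * A))
    (hσ : 0 ≤ σ) (hσA : σ * (34 * A / α) ≤ min (A / 8) (1 / (4 * α))) (P U Z : ℝ) :
    min (A / 8) (1 / (4 * α)) * (P ^ 2 + U ^ 2 + Z ^ 2)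
      ≤ energyRateForm m α 0 (1 / α) (10 * A / α) H σ P U Z
        + k * energyForm α 0 (1 / α) (10 * A / α) H σ P U Z := by
  set ε := min (A / 8) (1 / (4 * α))
  have hH0 : 0 < H := by linarith [hH.1]
  have hεP : ε * P ^ 2 ≤ A / 8 * P ^ 2 := by gcongr; exact min_le_left _ _
  have hεU : ε * U ^ 2 ≤ A / 8 * U ^ 2 := by gcongr; exact min_le_left _ _
  have hεZ : ε * Z ^ 2 ≤ 1 / (4 * α) * Z ^ 2 := by gcongr; exact min_le_right _ _
  have hPU : 0 ≤ H / 2 * P ^ 2 + (k + 1) * H * (P * U) + 9 / 2 * H * U ^ 2 := by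
    refine quadratic_form_nonneg (by positivity) ?_ P U
    have : (k + 1) ^ 2 ≤ 3 ^ 2 := sq_le_sq' (by linarith [hk.1]) (by linarith [hk.2])
    nlinarith [sq_nonneg H]
  have hcross₁ : |(k - 2) * H + 10 * A| ≤ 34 * A :=
    abs_le.2 ⟨by nlinarith [hk.1, hk.2, hH.2], by nlinarith [hk.1, hk.2, hH.2]⟩
  have hcross₂ : |10 * A * (m - 3 + k)| ≤ 34 * A :=
    abs_le.2 ⟨by nlinarith [hk.1, hk.2], by nlinarith [hk.1, hk.2]⟩
  have hZP := neg_le_of_abs_le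
    (abs_mul_mul_le_of_abs_le (abs_div_mul_le_of_abs_le hσ hα hcross₁ hσA) Z P)
  have hUZ := neg_le_of_abs_le
    (abs_mul_mul_le_of_abs_le (abs_div_mul_le_of_abs_le hσ hα hcross₂ hσA) U Z)
  have hHP : A / 2 * P ^ 2 ≤ H * P ^ 2 := by gcongr; exact hH.1
  have hHU : H * U ^ 2 ≤ 2 * A * U ^ 2 := by gcongr; exact hH.2
  have hZ : 2 * (1 / (4 * α) * Z ^ 2) ≤ (3 - k) / (2 * α) * Z ^ 2 := by
    rw [← mul_assoc, show 2 * (1 / (4 * α)) = 1 / (2 * α) by field_simp; norm_num]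
    gcongr
    linarith [hk.2]
  have : 0 ≤ A * P ^ 2 := by positivity
  have : 0 ≤ A * U ^ 2 := by positivity
  calc ε * (P ^ 2 + U ^ 2 + Z ^ 2)
      ≤ H * P ^ 2 + (k + 1) * H * (P * U) + 10 * A * U ^ 2 + (3 - k) / (2 * α) * Z ^ 2
        + σ / α * ((k - 2) * H + 10 * A) * (Z * P)
        + σ / α * (10 * A * (m - 3 + k)) * (U * Z) := by linarith
    _ = _ := by rw [energyRateForm, energyForm]; field_simp; ring

/-! ### Scaled variables -/

/-- The third derivative of a profile in the scaled variables, in which the mobility `f ^ m` becomes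
asymptotically constant. -/
noncomputable def scaledThirdDeriv (m : ℝ) (f : ℝ → ℝ) (y : ℝ) : ℝ :=
  y ^ (m / 2) * profileDeriv 3 f y

/-- The second derivative of a profile in the scaled variables. -/
noncomputable def scaledSecondDeriv (m : ℝ) (f : ℝ → ℝ) (y : ℝ) : ℝ :=
  y ^ (m / 2) * profileDeriv 2 f y / y

/-- The derivative of the flux of a profile in the scaled variables. -/
noncomputable def scaledFluxDeriv (α : ℝ) (f : ℝ → ℝ) (y : ℝ) : ℝ := profileFluxDeriv α f y / y

/-- The squared norm of the vector of scaled variables. -/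
noncomputable def scaledNormSq (m α : ℝ) (f : ℝ → ℝ) (y : ℝ) : ℝ :=
  scaledThirdDeriv m f y ^ 2 + scaledSecondDeriv m f y ^ 2 + scaledFluxDeriv α f y ^ 2

/-- The mobility `f ^ m` relative to its linear counterpart; it tends to `a ^ m`. -/
noncomputable def scaledMobility (m : ℝ) (f : ℝ → ℝ) (y : ℝ) : ℝ := f y ^ m / y ^ m

/-- The factor of the products with the scaled flux derivative. It is identically `1` for `m = 4`
and tends to `0` for `m < 4`. -/
noncomputable def couplingFactor (m y : ℝ) : ℝ := y ^ (m / 2) / y ^ 2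

/-- The reduced energy with three correction terms of weights `θ`, `c`, `e`. Its derivative and its
quotient by `y` are both quadratic forms in the scaled variables. -/
noncomputable def weightedEnergy (m α θ c e : ℝ) (f : ℝ → ℝ) (y : ℝ) : ℝ :=
  reducedEnergy m α f y + θ * (y ^ m * profileDeriv 2 f y ^ 2 / y)
    + c * (profileFlux m f y * profileFluxDeriv α f y / y ^ 2)
    + e * (y ^ m * (profileDeriv 2 f y * profileFluxDeriv α f y) / y ^ 3)

/-- The derivative of `weightedEnergy`. -/
noncomputable def weightedEnergyRate (m α θ c e : ℝ) (f : ℝ → ℝ) (y : ℝ) : ℝ :=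
  energyRateForm m α θ c e (scaledMobility m f y) (couplingFactor m y) (scaledThirdDeriv m f y)
    (scaledSecondDeriv m f y) (scaledFluxDeriv α f y)

theorem scaledNormSq_nonneg (m α : ℝ) (f : ℝ → ℝ) (y : ℝ) : 0 ≤ scaledNormSq m α f y := by
  unfold scaledNormSq
  positivity

theorem couplingFactor_mem_Icc {m y : ℝ} (hm4 : m ≤ 4) (hy : 1 ≤ y) :
    couplingFactor m y ∈ Icc 0 1 := by
  refine ⟨by unfold couplingFactor; positivity, ?_⟩
  rw [couplingFactor, div_le_one (by positivity), ← Real.rpow_natCast]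
  exact Real.rpow_le_rpow_of_exponent_le hy (by push_cast; linarith)

theorem couplingFactor_four {y : ℝ} (hy : y ≠ 0) : couplingFactor 4 y = 1 := by
  rw [couplingFactor, show (4 : ℝ) / 2 = (2 : ℕ) by norm_num, Real.rpow_natCast]
  exact div_self (pow_ne_zero 2 hy)

theorem tendsto_couplingFactor {m : ℝ} (hm4 : m < 4) :
    Tendsto (couplingFactor m) atTop (𝓝 0) := by
  refine (tendsto_rpow_neg_atTop (show 0 < 2 - m / 2 by linarith)).congr' ?_
  filter_upwards [eventually_ne_atTop 0] with y hy
  rw [couplingFactor, show -(2 - m / 2) = m / 2 - (2 : ℕ) by push_cast; ring,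
    Real.rpow_sub_natCast hy]

theorem weightedEnergy_div_eq {m α θ c e : ℝ} {f : ℝ → ℝ} {y : ℝ} (hα : α ≠ 0) (hy : 0 < y) :
    weightedEnergy m α θ c e f y / y = energyForm α θ c e (scaledMobility m f y)
      (couplingFactor m y) (scaledThirdDeriv m f y) (scaledSecondDeriv m f y)
      (scaledFluxDeriv α f y) := by
  have : 0 < y ^ (m / 2) := Real.rpow_pos_of_pos hy _
  simp only [weightedEnergy, reducedEnergy, profileFlux, energyForm, scaledMobility,
    couplingFactor, scaledThirdDeriv, scaledSecondDeriv, scaledFluxDeriv,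
    rpow_eq_rpow_half_sq hy.le m]
  field_simp

theorem reducedEnergy_deriv_eq {m α : ℝ} {f : ℝ → ℝ} {y : ℝ} (hy : 0 < y) :
    profileDissipation m f y + profileFluxDeriv α f y ^ 2 / (2 * α * y ^ 2)
      = scaledMobility m f y * scaledThirdDeriv m f y ^ 2
        + scaledFluxDeriv α f y ^ 2 / (2 * α) := by
  have : 0 < y ^ (m / 2) := Real.rpow_pos_of_pos hy _
  simp only [profileDissipation, scaledMobility, scaledThirdDeriv, scaledFluxDeriv,
    rpow_eq_rpow_half_sq hy.le m]
  field_simp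

theorem profileDeriv_one_eq_add {α : ℝ} {f : ℝ → ℝ} {y : ℝ} (hα : α ≠ 0) (hy : y ≠ 0) :
    profileDeriv 1 f y = f y / y + scaledFluxDeriv α f y / α := by
  rw [scaledFluxDeriv, profileFluxDeriv]
  field_simp
  ring

namespace IsProfile

variable {m α κ a : ℝ} {f : ℝ → ℝ}

theorem stronglyMeasurableAtFilter_scaledNormSq (h : IsProfile m α κ a f) :
    StronglyMeasurableAtFilter (scaledNormSq m α f) atTop := by
  have hsub : Ioi (0 : ℝ) ⊆ Ici 0 := Ioi_subset_Ici_self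
  have hne : ∀ x ∈ Ioi (0 : ℝ), x ≠ 0 := fun x hx => ne_of_gt hx
  have hpow : ContinuousOn (fun y : ℝ => y ^ (m / 2)) (Ioi 0) :=
    continuousOn_id.rpow_const fun x hx => Or.inl (hne x hx)
  have hcont : ContinuousOn (scaledNormSq m α f) (Ioi 0) :=
    (((hpow.mul ((h.continuousOn_profileDeriv le_rfl).mono hsub)).pow 2).add
      (((hpow.mul ((h.continuousOn_profileDeriv (by norm_num)).mono hsub)).div
        continuousOn_id hne).pow 2)).add
      (((h.continuousOn_profileFluxDeriv.mono hsub).div continuousOn_id hne).pow 2)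
  exact stronglyMeasurableAtFilter_atTop_of_continuousOn hcont

theorem tendsto_scaledMobility (h : IsProfile m α κ a f) (hm : 0 < m) (hα : 0 < α) :
    Tendsto (scaledMobility m f) atTop (𝓝 (a ^ m)) := by
  refine (h.linear_growth.rpow_const (Or.inl h.slope_pos.ne')).congr' ?_
  filter_upwards [eventually_gt_atTop 0] with y hy
  exact Real.div_rpow (h.pos hm hα hy.le).le hy.le m

theorem eventually_scaledMobility_mem_Icc (h : IsProfile m α κ a f) (hm : 0 < m) (hα : 0 < α)
    {r s : ℝ} (hr : r < 1) (hs : 1 < s) :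
    ∀ᶠ y in atTop, scaledMobility m f y ∈ Icc (r * a ^ m) (s * a ^ m) := by
  have ha : 0 < a ^ m := Real.rpow_pos_of_pos h.slope_pos m
  exact h.tendsto_scaledMobility hm hα
    (Icc_mem_nhds (mul_lt_of_lt_one_left ha hr) (lt_mul_of_one_lt_left ha hs))

theorem hasDerivAt_rpow_mul_secondDeriv_sq_div (h : IsProfile m α κ a f) {y : ℝ} (hy : 0 < y) :
    HasDerivAt (fun s => s ^ m * profileDeriv 2 f s ^ 2 / s)
      ((m - 1) * scaledSecondDeriv m f y ^ 2
        + 2 * (scaledThirdDeriv m f y * scaledSecondDeriv m f y)) y := by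
  refine (((hasDerivAt_rpow_div hy m).mul ((h.hasDerivAt_profileDeriv (by norm_num) hy).pow 2)).div
    (hasDerivAt_id y) hy.ne').congr_deriv ?_
  simp only [scaledThirdDeriv, scaledSecondDeriv, rpow_eq_rpow_half_sq hy.le m, Pi.mul_apply,
    Pi.pow_apply, id]
  field_simp
  push_cast
  ring

theorem hasDerivAt_flux_mul_fluxDeriv_div_sq (h : IsProfile m α κ a f) {y : ℝ} (hy : 0 < y) :
    HasDerivAt (fun s => profileFlux m f s * profileFluxDeriv α f s / s ^ 2)
      (scaledFluxDeriv α f y ^ 2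
        + α * (scaledMobility m f y * (scaledThirdDeriv m f y * scaledSecondDeriv m f y))
        - 2 * (scaledMobility m f y * couplingFactor m y
          * (scaledFluxDeriv α f y * scaledThirdDeriv m f y))) y := by
  refine (((h.hasDerivAt_profileFlux hy).mul (h.hasDerivAt_profileFluxDeriv hy)).div
    (hasDerivAt_pow 2 y) (by positivity)).congr_deriv ?_
  have : 0 < y ^ (m / 2) := Real.rpow_pos_of_pos hy _
  simp only [profileFlux, scaledMobility, couplingFactor, scaledThirdDeriv, scaledSecondDeriv,
    scaledFluxDeriv, rpow_eq_rpow_half_sq hy.le m, Pi.mul_apply]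
  field_simp
  push_cast
  ring

theorem hasDerivAt_rpow_mul_secondDeriv_mul_fluxDeriv_div_cube (h : IsProfile m α κ a f) {y : ℝ}
    (hy : 0 < y) :
    HasDerivAt (fun s => s ^ m * (profileDeriv 2 f s * profileFluxDeriv α f s) / s ^ 3)
      ((m - 3) * (couplingFactor m y * (scaledSecondDeriv m f y * scaledFluxDeriv α f y))
        + couplingFactor m y * (scaledFluxDeriv α f y * scaledThirdDeriv m f y)
        + α * scaledSecondDeriv m f y ^ 2) y := by
  refine (((hasDerivAt_rpow_div hy m).mul ((h.hasDerivAt_profileDeriv (by norm_num) hy).mul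
    (h.hasDerivAt_profileFluxDeriv hy))).div (hasDerivAt_pow 3 y) (by positivity)).congr_deriv ?_
  simp only [couplingFactor, scaledThirdDeriv, scaledSecondDeriv, scaledFluxDeriv,
    rpow_eq_rpow_half_sq hy.le m, Pi.mul_apply]
  field_simp
  push_cast
  ring

theorem hasDerivAt_weightedEnergy (h : IsProfile m α κ a f) (hα : 0 < α) (θ c e : ℝ) {y : ℝ}
    (hy : 0 < y) :
    HasDerivAt (weightedEnergy m α θ c e f) (weightedEnergyRate m α θ c e f y) y := by
  refine ((((h.hasDerivAt_reducedEnergy hα hy).add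
    ((h.hasDerivAt_rpow_mul_secondDeriv_sq_div hy).const_mul θ)).add
      ((h.hasDerivAt_flux_mul_fluxDeriv_div_sq hy).const_mul c)).add
        ((h.hasDerivAt_rpow_mul_secondDeriv_mul_fluxDeriv_div_cube hy).const_mul e)).congr_deriv ?_
  rw [reducedEnergy_deriv_eq hy, weightedEnergyRate, energyRateForm]

theorem exists_weightedEnergy_div_le (h : IsProfile m α κ a f) (hm : 0 < m) (hm4 : m ≤ 4)
    (hα : 0 < α) (θ c e : ℝ) :
    ∃ D, 0 < D ∧ ∀ᶠ y in atTop, weightedEnergy m α θ c e f y / y ≤ D * scaledNormSq m α f y := by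
  have ha : 0 < a ^ m := Real.rpow_pos_of_pos h.slope_pos m
  refine ⟨a ^ m + |θ| + |c| * a ^ m + |e|, by positivity, ?_⟩
  filter_upwards [h.eventually_scaledMobility_mem_Icc hm hα zero_lt_one one_lt_two,
    eventually_ge_atTop 1] with y hH hy
  rw [weightedEnergy_div_eq hα.ne' (one_pos.trans_le hy)]
  exact energyForm_le hα (by simpa only [zero_mul] using hH) (couplingFactor_mem_Icc hm4 hy) _ _ _

theorem exists_weightedEnergyRate_coercive (h : IsProfile m α κ a f) (hm : 0 < m) (hm4 : m ≤ 4)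
    (hα : 0 < α) :
    ∃ e ε, 0 < e ∧ 0 < ε ∧
      ∀ᶠ y in atTop, ε * scaledNormSq m α f y ≤ weightedEnergyRate m α 0 0 e f y := by
  have ha : 0 < a ^ m := Real.rpow_pos_of_pos h.slope_pos m
  set e := min (a ^ m / 2) (1 / (18 + 2 * α))
  have he : 0 < e := by positivity
  refine ⟨e, min (a ^ m / 4) (min (e * α / 2) (1 / (4 * α))), he, by positivity, ?_⟩
  filter_upwards [h.eventually_scaledMobility_mem_Icc hm hα one_half_lt_one one_lt_two,
    eventually_ge_atTop 1] with y hH hy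
  exact energyRateForm_coercive hm.le hm4 hα he (min_le_left _ _)
    ((le_div_iff₀ (by positivity)).1 (min_le_right _ _)) (by linarith [hH.1])
    (couplingFactor_mem_Icc hm4 hy) _ _ _

/-- The rate stays coercive after adding multiples of `weightedEnergy / y`, so the weighted energy
may be multiplied by a power of `y` larger than one. -/
theorem exists_weightedEnergyRate_add_mul_coercive (h : IsProfile m α κ a f) (hm : 0 < m)
    (hm4 : m ≤ 4) (hα : 0 < α) :
    ∃ θ c e K ε, 1 < K ∧ 0 < ε ∧ ∀ᶠ y in atTop, ∀ k ∈ Icc 0 K, ε * scaledNormSq m α f y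
      ≤ weightedEnergyRate m α θ c e f y + k * (weightedEnergy m α θ c e f y / y) := by
  have ha : 0 < a ^ m := Real.rpow_pos_of_pos h.slope_pos m
  rcases hm4.eq_or_lt with rfl | hlt
  · set A := a ^ (4 : ℝ)
    set c := 1 / (100 * (α + A)) with hc
    have hc0 : 0 < c := by positivity
    have hcα : α * c ≤ 1 / 100 := by
      rw [hc, mul_one_div, div_le_div_iff₀ (by positivity) (by positivity)]
      linarith
    have hcA : A * c ≤ 1 / 100 := by
      rw [hc, mul_one_div, div_le_div_iff₀ (by positivity) (by positivity)]
      linarith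
    refine ⟨A, c, 0, 1 + α * c, min (A / 10) (c / 4), by linarith [mul_pos hα hc0],
      by positivity, ?_⟩
    filter_upwards [h.eventually_scaledMobility_mem_Icc (r := 99 / 100) (s := 101 / 100) hm hα
      (by norm_num) (by norm_num), eventually_gt_atTop 0] with y hH hy k hk
    rw [weightedEnergy_div_eq hα.ne' hy, weightedEnergyRate, couplingFactor_four hy.ne']
    exact energyRateForm_add_mul_energyForm_coercive_of_eq_four hα ha hc0 hcα hcA hk hH _ _ _
  · have hε : 0 < min (a ^ m / 8) (1 / (4 * α)) := by positivity
    refine ⟨0, 1 / α, 10 * a ^ m / α, 2, _, one_lt_two, hε, ?_⟩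
    have hσ := (tendsto_couplingFactor hlt).mul_const (34 * a ^ m / α)
    rw [zero_mul] at hσ
    filter_upwards [h.eventually_scaledMobility_mem_Icc hm hα one_half_lt_one one_lt_two,
      hσ.eventually_le_const hε, eventually_ge_atTop 1] with y hH hσy hy k hk
    rw [weightedEnergy_div_eq hα.ne' (one_pos.trans_le hy)]
    exact energyRateForm_add_mul_energyForm_coercive_of_small_coupling hm.le hlt.le hα ha hk
      ⟨by linarith [hH.1], hH.2⟩ (couplingFactor_mem_Icc hlt.le hy).1 hσy _ _ _

/-! ### Decay at infinity -/

theorem stronglyMeasurableAtFilter_scaledFluxDeriv (h : IsProfile m α κ a f) :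
    StronglyMeasurableAtFilter (scaledFluxDeriv α f) atTop :=
  stronglyMeasurableAtFilter_atTop_of_continuousOn
    ((h.continuousOn_profileFluxDeriv.mono Ioi_subset_Ici_self).div continuousOn_id
      fun _ hy => ne_of_gt hy)

theorem integrableAtFilter_profileDissipation (h : IsProfile m α κ a f) (hm : 0 < m)
    (hα : 0 < α) : IntegrableAtFilter (profileDissipation m f) atTop := by
  refine integrableAtFilter_of_le_hasDerivAt ((eventually_gt_atTop 0).mono fun y hy =>
    h.hasDerivAt_reducedEnergy hα hy) (stronglyMeasurableAtFilter_atTop_of_continuousOn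
      ((h.continuousOn_profileDissipation hm).mono Ioi_subset_Ici_self))
    ((eventually_ge_atTop 0).mono fun y hy => h.profileDissipation_nonneg hm hα hy)
    (.of_forall fun y => ?_) (h.frequently_reducedEnergy_nonpos hm hα)
  have : 0 ≤ profileFluxDeriv α f y ^ 2 / (2 * α * y ^ 2) := by positivity
  linarith

theorem integrableAtFilter_scaledFluxDeriv_sq (h : IsProfile m α κ a f) (hm : 0 < m)
    (hα : 0 < α) : IntegrableAtFilter (fun y => scaledFluxDeriv α f y ^ 2) atTop := by
  have hmeas : StronglyMeasurableAtFilter (fun y => scaledFluxDeriv α f y ^ 2) atTop := by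
    obtain ⟨s, hs, hmeas⟩ := h.stronglyMeasurableAtFilter_scaledFluxDeriv
    exact ⟨s, hs, hmeas.pow 2⟩
  refine integrableAtFilter_of_le_hasDerivAt (C := 0) ((eventually_gt_atTop 0).mono fun y hy =>
    (h.hasDerivAt_reducedEnergy hα hy).const_mul (2 * α)) hmeas
    (.of_forall fun y => sq_nonneg _) ?_ ((h.frequently_reducedEnergy_nonpos hm hα).mono
      fun y hy => mul_nonpos_of_nonneg_of_nonpos (by positivity) hy)
  filter_upwards [eventually_gt_atTop 0] with y hy
  have hdiss := h.profileDissipation_nonneg hm hα hy.le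
  calc scaledFluxDeriv α f y ^ 2
      = 2 * α * (profileFluxDeriv α f y ^ 2 / (2 * α * y ^ 2)) := by
        rw [scaledFluxDeriv]; field_simp
    _ ≤ _ := by gcongr; linarith

/-- Otherwise `y * f'' * z ≥ 1` eventually, where `z` is the derivative of the flux. As
`z' = α * y * f''`, this makes `z ^ 2` grow linearly, so `(z / y) ^ 2` would not be integrable. -/
theorem frequently_rpow_mul_secondDeriv_mul_fluxDeriv_div_cube_le_one (h : IsProfile m α κ a f)
    (hm : 0 < m) (hm4 : m ≤ 4) (hα : 0 < α) :
    ∃ᶠ y in atTop,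
      y ^ m * (profileDeriv 2 f y * profileFluxDeriv α f y) / y ^ 3 ≤ 1 := by
  intro hnot
  have hone : ∀ᶠ y in atTop, 1 ≤ y * (profileDeriv 2 f y * profileFluxDeriv α f y) := by
    filter_upwards [hnot, eventually_ge_atTop 1] with y hy hy1
    have hy0 : 0 < y := one_pos.trans_le hy1
    have hpow : y ^ m ≤ y ^ 4 := by
      simpa using Real.rpow_le_rpow_of_exponent_le (z := (4 : ℕ)) hy1 (by exact_mod_cast hm4)
    have hym : 0 < y ^ m := Real.rpow_pos_of_pos hy0 m
    rw [not_le, one_lt_div (by positivity)] at hy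
    have hprod : 0 < profileDeriv 2 f y * profileFluxDeriv α f y :=
      (mul_pos_iff_of_pos_left hym).1 ((by positivity : 0 < y ^ 3).trans hy)
    refine le_of_mul_le_mul_left ?_ (by positivity : 0 < y ^ 3)
    calc y ^ 3 * 1 ≤ y ^ m * (profileDeriv 2 f y * profileFluxDeriv α f y) := by linarith
      _ ≤ y ^ 4 * (profileDeriv 2 f y * profileFluxDeriv α f y) := by gcongr
      _ = _ := by ring
  have hgrowth : Tendsto (fun y => profileFluxDeriv α f y ^ 2 - α * y) atTop atTop := by
    refine tendsto_atTop_of_le_hasDerivAt hα ((eventually_gt_atTop 0).mono fun y hy =>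
      ((h.hasDerivAt_profileFluxDeriv hy).pow 2).sub ((hasDerivAt_id y).const_mul α)) ?_
    filter_upwards [hone] with y hy
    have := mul_le_mul_of_nonneg_left hy hα.le
    norm_num
    linarith
  refine frequently_lt_div_of_integrableAtFilter hα
    (h.integrableAtFilter_scaledFluxDeriv_sq hm hα) ?_
  filter_upwards [hgrowth.eventually_ge_atTop 0, eventually_gt_atTop 0] with y hy hy0
  rw [not_lt, scaledFluxDeriv, div_pow, div_le_div_iff₀ hy0 (by positivity)]
  nlinarith

theorem integrableAtFilter_scaledNormSq (h : IsProfile m α κ a f) (hm : 0 < m) (hm4 : m ≤ 4)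
    (hα : 0 < α) : IntegrableAtFilter (scaledNormSq m α f) atTop := by
  obtain ⟨e, ε, he, hε, hcoercive⟩ := h.exists_weightedEnergyRate_coercive hm hm4 hα
  have hmeas : StronglyMeasurableAtFilter (ε • scaledNormSq m α f) atTop := by
    obtain ⟨s, hs, hmeas⟩ := h.stronglyMeasurableAtFilter_scaledNormSq
    exact ⟨s, hs, hmeas.const_smul ε⟩
  have hint : IntegrableAtFilter (ε • scaledNormSq m α f) atTop := by
    refine integrableAtFilter_of_le_hasDerivAt (C := e) ((eventually_gt_atTop 0).mono fun y hy =>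
      h.hasDerivAt_weightedEnergy hα 0 0 e hy) hmeas
      (.of_forall fun y => mul_nonneg hε.le (scaledNormSq_nonneg m α f y)) hcoercive ?_
    refine ((h.frequently_rpow_mul_secondDeriv_mul_fluxDeriv_div_cube_le_one hm hm4
      hα).and_eventually (eventually_gt_atTop 0)).mono fun y hy => ?_
    rw [weightedEnergy, zero_mul, zero_mul, add_zero, add_zero]
    linarith [h.reducedEnergy_nonpos hm hα hy.2, mul_le_mul_of_nonneg_left hy.1 he.le]
  simpa [smul_smul, inv_mul_cancel₀ hε.ne'] using hint.smul ε⁻¹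

theorem exists_integrableAtFilter_rpow_mul_scaledNormSq (h : IsProfile m α κ a f) (hm : 0 < m)
    (hm4 : m ≤ 4) (hα : 0 < α) :
    ∃ K : ℝ, 1 < K ∧ IntegrableAtFilter (fun y => y ^ K * scaledNormSq m α f y) atTop := by
  obtain ⟨θ, c, e, K, ε, hK, hε, hcoercive⟩ :=
    h.exists_weightedEnergyRate_add_mul_coercive hm hm4 hα
  obtain ⟨D, hD, hle⟩ := h.exists_weightedEnergy_div_le hm hm4 hα θ c e
  have hK0 : 0 ≤ K := zero_le_one.trans hK.le
  have hderiv := (eventually_gt_atTop 0).mono fun y hy => h.hasDerivAt_weightedEnergy hα θ c e hy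
  refine ⟨K, hK, integrableAtFilter_rpow_mul_of_lyapunov hε hderiv
    (.of_forall (scaledNormSq_nonneg m α f)) (hcoercive.mono fun y hy => ?_)
    (hcoercive.mono fun y hy => hy K (right_mem_Icc.2 hK0)) hD hle
    (h.integrableAtFilter_scaledNormSq hm hm4 hα)⟩
  simpa only [zero_mul, add_zero] using hy 0 (left_mem_Icc.2 hK0)

theorem exists_integrableAtFilter_rpow_mul_scaledFluxDeriv (h : IsProfile m α κ a f) (hm : 0 < m)
    (hm4 : m ≤ 4) (hα : 0 < α) :
    ∃ p : ℝ, 0 < p ∧ IntegrableAtFilter (fun y => y ^ p * scaledFluxDeriv α f y) atTop := by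
  obtain ⟨K, hK, hint⟩ := h.exists_integrableAtFilter_rpow_mul_scaledNormSq hm hm4 hα
  have hmeas := h.stronglyMeasurableAtFilter_scaledFluxDeriv
  have hsq : IntegrableAtFilter (fun y => y ^ K * scaledFluxDeriv α f y ^ 2) atTop := by
    obtain ⟨s, hs, hmeass⟩ := hmeas
    refine Asymptotics.IsBigO.integrableAtFilter (.of_bound 1 ?_) ⟨s, hs,
      (by fun_prop : Measurable fun y : ℝ => y ^ K).aestronglyMeasurable.mul (hmeass.pow 2)⟩ hint
    refine .of_forall fun y => ?_
    rw [one_mul, norm_mul, norm_mul, Real.norm_of_nonneg (sq_nonneg _),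
      Real.norm_of_nonneg (scaledNormSq_nonneg m α f y)]
    gcongr
    exact le_add_of_nonneg_left (by positivity)
  exact ⟨(K - 1) / 4, by linarith, integrableAtFilter_rpow_mul_of_sq (by linarith) hmeas hsq⟩

theorem hasDerivAt_div_self (h : IsProfile m α κ a f) (hα : α ≠ 0) {y : ℝ} (hy : 0 < y) :
    HasDerivAt (fun s => f s / s) (scaledFluxDeriv α f y / (α * y)) y := by
  refine ((h.hasDerivAt hy).div (hasDerivAt_id y) hy.ne').congr_deriv ?_
  simp only [scaledFluxDeriv, profileFluxDeriv, id]
  field_simp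
  ring

theorem exists_isBigO_div_self_sub_slope (h : IsProfile m α κ a f) (hm : 0 < m) (hm4 : m ≤ 4)
    (hα : 0 < α) :
    ∃ q : ℝ, 1 < q ∧ (fun y => f y / y - a) =O[atTop] fun y => y ^ (-q) := by
  obtain ⟨p, hp, hint⟩ := h.exists_integrableAtFilter_rpow_mul_scaledFluxDeriv hm hm4 hα
  refine ⟨p + 1, by linarith, isBigO_sub_rpow_neg_of_integrableAtFilter (by linarith)
    ((eventually_gt_atTop 0).mono fun y hy => h.hasDerivAt_div_self hα.ne' hy) h.linear_growth ?_⟩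
  refine (hint.smul α⁻¹).congr ?_
  filter_upwards [Measure.ae_ne volume 0] with y hy
  rw [Pi.smul_apply, smul_eq_mul, Real.rpow_add_one hy]
  field_simp

theorem tendsto_sub_slope_mul (h : IsProfile m α κ a f) (hm : 0 < m) (hm4 : m ≤ 4)
    (hα : 0 < α) : Tendsto (fun y => f y - a * y) atTop (𝓝 0) := by
  obtain ⟨q, hq, hO⟩ := h.exists_isBigO_div_self_sub_slope hm hm4 hα
  refine ((hO.mul (Asymptotics.isBigO_refl id atTop)).congr' ?_ ?_).trans_tendsto
    (tendsto_rpow_neg_atTop (sub_pos.2 hq))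
  · filter_upwards [eventually_ne_atTop 0] with y hy
    simp only [id]
    field_simp
  · filter_upwards [eventually_gt_atTop 0] with y hy
    rw [id, ← Real.rpow_add_one hy.ne', neg_sub, neg_add_eq_sub]

theorem integrableAtFilter_scaledFluxDeriv (h : IsProfile m α κ a f) (hm : 0 < m) (hm4 : m ≤ 4)
    (hα : 0 < α) : IntegrableAtFilter (scaledFluxDeriv α f) atTop := by
  obtain ⟨p, hp, hint⟩ := h.exists_integrableAtFilter_rpow_mul_scaledFluxDeriv hm hm4 hα
  refine Asymptotics.IsBigO.integrableAtFilter (.of_bound 1 ?_)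
    h.stronglyMeasurableAtFilter_scaledFluxDeriv hint
  filter_upwards [eventually_ge_atTop 1] with y hy
  rw [one_mul, norm_mul]
  exact le_mul_of_one_le_left (norm_nonneg _)
    ((Real.one_le_rpow hy hp.le).trans (Real.le_norm_self _))

theorem integrableAtFilter_div_self_sub_slope (h : IsProfile m α κ a f) (hm : 0 < m)
    (hm4 : m ≤ 4) (hα : 0 < α) : IntegrableAtFilter (fun y => f y / y - a) atTop := by
  obtain ⟨q, hq, hO⟩ := h.exists_isBigO_div_self_sub_slope hm hm4 hα
  refine hO.integrableAtFilter (stronglyMeasurableAtFilter_atTop_of_continuousOn (b := 0) ?_)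
    (integrableAtFilter_rpow_atTop_iff.2 (by linarith))
  exact ((h.contDiffOn.continuousOn.mono Ioi_subset_Ici_self).div continuousOn_id
    fun _ hy => ne_of_gt hy).sub continuousOn_const

theorem integrableOn_profileDeriv_one_sq_sub (h : IsProfile m α κ a f) (hm : 0 < m)
    (hm4 : m ≤ 4) (hα : 0 < α) :
    IntegrableOn (fun y => profileDeriv 1 f y ^ 2 - a ^ 2) (Ioi 0) := by
  have hslope := h.integrableAtFilter_div_self_sub_slope hm hm4 hα
  have hflux := h.integrableAtFilter_scaledFluxDeriv hm hm4 hα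
  have hflux_sq := h.integrableAtFilter_scaledFluxDeriv_sq hm hα
  have hcont : ContinuousOn (fun y => profileDeriv 1 f y ^ 2 - a ^ 2) (Ici 0) :=
    ((h.continuousOn_profileDeriv (by norm_num)).pow 2).sub continuousOn_const
  refine integrableOn_Ioi_of_continuousOn_of_integrableAtFilter hcont
    (Asymptotics.IsBigO.integrableAtFilter (.of_bound 1 ?_)
      (stronglyMeasurableAtFilter_atTop_of_continuousOn (hcont.mono Ioi_subset_Ici_self))
      (((hslope.norm.smul (3 * a)).add (hflux.norm.smul (4 * a / α))).add
        (hflux_sq.smul (α ^ 2)⁻¹)))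
  have ha := h.slope_pos
  have hbdd : ∀ᶠ y in atTop, f y / y ∈ Icc 0 (2 * a) :=
    h.linear_growth (Icc_mem_nhds ha (by linarith))
  filter_upwards [hbdd, eventually_ne_atTop 0] with y hy hy0
  rw [profileDeriv_one_eq_add hα.ne' hy0, one_mul, Real.norm_eq_abs]
  calc _ ≤ _ := abs_add_sq_sub_sq_le ha.le hy _
    _ = 3 * a * |f y / y - a| + 4 * a / α * |scaledFluxDeriv α f y|
        + (α ^ 2)⁻¹ * scaledFluxDeriv α f y ^ 2 := by
      rw [abs_div, abs_of_pos hα]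
      ring
    _ ≤ _ := Real.le_norm_self _

/-! ### Energy balance -/

theorem integrableOn_profileDissipation (h : IsProfile m α κ a f) (hm : 0 < m) (hα : 0 < α) :
    IntegrableOn (profileDissipation m f) (Ioi 0) :=
  integrableOn_Ioi_of_continuousOn_of_integrableAtFilter (h.continuousOn_profileDissipation hm)
    (h.integrableAtFilter_profileDissipation hm hα)

theorem energyBalance_le (h : IsProfile m α κ a f) (hm : 0 < m) (hα : 0 < α) {y : ℝ}
    (hy : 0 < y) :
    ∫ x in 0..y, (α / 2 * (profileDeriv 1 f x ^ 2 - a ^ 2) + profileDissipation m f x)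
      ≤ α / 2 * ((f y - a * y) * (f y / y + a)) := by
  have hcont : ContinuousOn
      (fun x => α / 2 * (profileDeriv 1 f x ^ 2 - a ^ 2) + profileDissipation m f x) (Icc 0 y) :=
    (continuousOn_const.mul (((h.continuousOn_profileDeriv (by norm_num)).pow 2).sub
      continuousOn_const)).add (h.continuousOn_profileDissipation hm) |>.mono Icc_subset_Ici_self
  have hftc := intervalIntegral.integral_eq_sub_of_hasDerivAt_of_le hy.le
    (f := fun x => cumulativeEnergy m α f x - α / 2 * a ^ 2 * x)
    (((h.continuousOn_cumulativeEnergy hm).mono Icc_subset_Ici_self).sub (by fun_prop))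
    (fun x hx => ((h.hasDerivAt_cumulativeEnergy hx.1).sub
      ((hasDerivAt_id x).const_mul (α / 2 * a ^ 2))).congr_deriv (by ring))
    (hcont.intervalIntegrable_of_Icc hy.le)
  have hreduced := h.reducedEnergy_nonpos hm hα hy
  rw [reducedEnergy_eq_cumulativeEnergy_sub hy.ne'] at hreduced
  calc _ = cumulativeEnergy m α f y - α / 2 * a ^ 2 * y := by
        rw [hftc, h.cumulativeEnergy_zero, mul_zero, sub_zero, sub_zero]
    _ ≤ α / 2 * f y ^ 2 / y - α / 2 * a ^ 2 * y := by linarith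
    _ = _ := by field_simp; ring

theorem integral_profileDeriv_one_sq_sub_le (h : IsProfile m α κ a f) (hm : 0 < m) (hm4 : m ≤ 4)
    (hα : 0 < α) :
    α / 2 * ∫ y in Ioi 0, (profileDeriv 1 f y ^ 2 - a ^ 2)
      ≤ -∫ y in Ioi 0, profileDissipation m f y := by
  have henergy := (h.integrableOn_profileDeriv_one_sq_sub hm hm4 hα).const_mul (α / 2)
  have hdiss := h.integrableOn_profileDissipation hm hα
  have hbound : Tendsto (fun y => α / 2 * ((f y - a * y) * (f y / y + a))) atTop (𝓝 0) := by
    simpa using ((h.tendsto_sub_slope_mul hm hm4 hα).mul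
      (h.linear_growth.add_const a)).const_mul (α / 2)
  have hle := le_of_tendsto_of_tendsto
    (intervalIntegral_tendsto_integral_Ioi 0 (henergy.add hdiss) tendsto_id) hbound
    ((eventually_gt_atTop 0).mono fun y hy => h.energyBalance_le hm hα hy)
  rw [integral_add' henergy hdiss, integral_const_mul] at hle
  linarith

theorem exists_profileDissipation_ne_zero (h : IsProfile m α κ a f) (hm : 0 < m) (hα : 0 < α) :
    ∃ y, 0 < y ∧ profileDissipation m f y ≠ 0 := by
  by_contra! hzero
  have hflux : ∀ y ∈ Ioi (0 : ℝ), profileFlux m f y = 0 := fun y hy => by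
    have hf₃ := (mul_eq_zero.1 (hzero y hy)).resolve_left
      (Real.rpow_pos_of_pos (h.pos hm hα (le_of_lt hy)) m).ne'
    rw [profileFlux, pow_eq_zero_iff two_ne_zero |>.1 hf₃, mul_zero]
  have hfluxDeriv : EqOn (profileFluxDeriv α f) 0 (Ioi 0) := fun y hy =>
    (h.hasDerivAt_profileFlux hy).unique ((hasDerivAt_const y (0 : ℝ)).congr_of_eventuallyEq
      (by filter_upwards [Ioi_mem_nhds hy] with x hx using hflux x hx))
  have hfluxDeriv_zero : profileFluxDeriv α f 0 = 0 :=
    hfluxDeriv.of_subset_closure h.continuousOn_profileFluxDeriv continuousOn_const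
      Ioi_subset_Ici_self (closure_Ioi (0 : ℝ)).ge self_mem_Ici
  simp only [profileFluxDeriv, h.init_zero, zero_mul, sub_zero, mul_one] at hfluxDeriv_zero
  linarith

theorem integral_profileDissipation_pos (h : IsProfile m α κ a f) (hm : 0 < m) (hα : 0 < α) :
    0 < ∫ y in Ioi 0, profileDissipation m f y := by
  have hnonneg : 0 ≤ᵐ[volume.restrict (Ioi 0)] profileDissipation m f :=
    (ae_restrict_mem measurableSet_Ioi).mono fun y hy =>
      h.profileDissipation_nonneg hm hα (le_of_lt hy)
  refine (integral_nonneg_of_ae hnonneg).lt_of_ne' fun hzero => ?_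
  rw [integral_eq_zero_iff_of_nonneg_ae hnonneg (h.integrableOn_profileDissipation hm hα)] at hzero
  obtain ⟨y, hy, hne⟩ := h.exists_profileDissipation_ne_zero hm hα
  exact hne (Measure.eqOn_open_of_ae_eq hzero isOpen_Ioi
    ((h.continuousOn_profileDissipation hm).mono Ioi_subset_Ici_self) continuousOn_const hy)

theorem integral_profileDeriv_one_sq_sub_neg (h : IsProfile m α κ a f) (hm : 0 < m) (hm4 : m ≤ 4)
    (hα : 0 < α) : ∫ y in Ioi 0, (profileDeriv 1 f y ^ 2 - a ^ 2) < 0 := by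
  have hle := h.integral_profileDeriv_one_sq_sub_le hm hm4 hα
  have := h.integral_profileDissipation_pos hm hα
  exact neg_of_mul_neg_right (by linarith : α / 2 * _ < 0) (by positivity)

end IsProfile

/-! ### Self-similar solutions -/

theorem integrable_comp_abs_div {ψ : ℝ → ℝ} (hψ : IntegrableOn ψ (Ioi 0)) {T : ℝ} (hT : 0 < T) :
    Integrable fun x => ψ (|x| / T) := by
  have hpos : IntegrableOn (fun x => ψ |x|) (Ioi 0) :=
    hψ.congr_fun (fun x hx => by rw [abs_of_pos hx]) measurableSet_Ioi
  have hneg : IntegrableOn (fun x => ψ |x|) (Iic 0) := by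
    simpa using (Iff.mpr integrableOn_Ici_iff_integrableOn_Ioi hpos).comp_neg
  have habs : Integrable fun x => ψ |x| := by
    rw [← integrableOn_univ, ← Iic_union_Ioi (a := (0 : ℝ))]
    exact hneg.union hpos
  simpa only [abs_div, abs_of_pos hT] using habs.comp_div hT.ne'

theorem integral_comp_abs_div (ψ : ℝ → ℝ) {T : ℝ} (hT : 0 < T) :
    ∫ x, ψ (|x| / T) = T * (2 * ∫ y in Ioi 0, ψ y) := by
  simpa only [abs_div, abs_of_pos hT, integral_comp_abs, smul_eq_mul] using
    Measure.integral_comp_div (fun z => ψ |z|) T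

theorem deriv_const_mul_comp_abs_div_eventuallyEq {g g' : ℝ → ℝ}
    (hg : ∀ y, 0 < y → HasDerivAt g (g' y) y) {T : ℝ} (hT : 0 < T) (c : ℝ) {x : ℝ} (hx : x ≠ 0) :
    deriv (fun z => c * g (|z| / T)) =ᶠ[𝓝 x]
      fun z => c * (SignType.sign x : ℝ) / T * g' (|z| / T) := by
  have hsign : ∀ᶠ z in 𝓝 x, SignType.sign z = SignType.sign x :=
    (continuousAt_sign_of_ne_zero hx).eventually (p := (· = SignType.sign x)) (by simp)
  filter_upwards [hsign, eventually_ne_nhds hx] with z hz hz0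
  have hcomp := ((hg (|z| / T) (div_pos (abs_pos.2 hz0) hT)).comp z
    ((hasDerivAt_abs hz0).div_const T)).const_mul c
  rw [hz] at hcomp
  refine hcomp.deriv.trans ?_
  ring

theorem coe_sign_sq {x : ℝ} (hx : x ≠ 0) : (SignType.sign x : ℝ) ^ 2 = 1 := by
  rcases hx.lt_or_gt with h | h
  · simp [sign_neg h]
  · simp [sign_pos h]

theorem deriv_cone_sq (a : ℝ) {x : ℝ} (hx : x ≠ 0) : deriv (cone a) x ^ 2 = a ^ 2 := by
  have hcone : HasDerivAt (cone a) (a * SignType.sign x) x := (hasDerivAt_abs hx).const_mul a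
  rw [hcone.deriv, mul_pow, coe_sign_sq hx, mul_one]

/-- The self-similar solution with profile `f` and length scale `T t` at time `t`. Both
`powerSelfSimilar` and `expSelfSimilar` are of this form. -/
noncomputable def selfSimilar (T f : ℝ → ℝ) (x t : ℝ) : ℝ := T t * f (|x| / T t)

namespace IsProfile

variable {m α κ a : ℝ} {f T : ℝ → ℝ} {t : ℝ}

theorem deriv_selfSimilar_sq (h : IsProfile m α κ a f) (hT : 0 < T t) {x : ℝ} (hx : x ≠ 0) :
    deriv (fun z => selfSimilar T f z t) x ^ 2 = profileDeriv 1 f (|x| / T t) ^ 2 := by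
  have hderiv := deriv_const_mul_comp_abs_div_eventuallyEq (fun _ => h.hasDerivAt) hT (T t) hx
  rw [show deriv (fun z => selfSimilar T f z t) x = _ from hderiv.eq_of_nhds, mul_div_right_comm,
    div_self hT.ne', one_mul, mul_pow, coe_sign_sq hx, one_mul]

theorem iteratedDeriv_three_selfSimilar_sq (h : IsProfile m α κ a f) (hT : 0 < T t) {x : ℝ}
    (hx : x ≠ 0) :
    iteratedDeriv 3 (fun z => selfSimilar T f z t) x ^ 2
      = profileDeriv 3 f (|x| / T t) ^ 2 / T t ^ 4 := by
  have hf₁ := deriv_const_mul_comp_abs_div_eventuallyEq (fun _ => h.hasDerivAt) hT (T t) hx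
  have hf₂ := hf₁.deriv.trans (deriv_const_mul_comp_abs_div_eventuallyEq
    (fun _ => h.hasDerivAt_profileDeriv (by norm_num)) hT _ hx)
  have hf₃ := hf₂.deriv.trans (deriv_const_mul_comp_abs_div_eventuallyEq
    (fun _ => h.hasDerivAt_profileDeriv (by norm_num)) hT _ hx)
  simp only [selfSimilar]
  rw [iteratedDeriv_succ, iteratedDeriv_succ, iteratedDeriv_one, hf₃.eq_of_nhds]
  calc _ = ((SignType.sign x : ℝ) ^ 2) ^ 3 * (profileDeriv 3 f (|x| / T t) ^ 2 / T t ^ 4) := by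
        field_simp
    _ = _ := by rw [coe_sign_sq hx, one_pow, one_mul]

theorem energyDensityChange_ae_eq (h : IsProfile m α κ a f) (hT : 0 < T t) :
    energyDensityChange (selfSimilar T f) (cone a) t =ᵐ[volume]
      fun x => profileDeriv 1 f (|x| / T t) ^ 2 - a ^ 2 := by
  filter_upwards [Measure.ae_ne volume 0] with x hx
  rw [energyDensityChange, deriv_cone_sq a hx, h.deriv_selfSimilar_sq hT hx]

theorem integrable_energyDensityChange (h : IsProfile m α κ a f) (hm : 0 < m) (hm4 : m ≤ 4)
    (hα : 0 < α) (hT : 0 < T t) :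
    Integrable (energyDensityChange (selfSimilar T f) (cone a) t) :=
  (integrable_comp_abs_div (h.integrableOn_profileDeriv_one_sq_sub hm hm4 hα) hT).congr
    (h.energyDensityChange_ae_eq hT).symm

theorem half_integral_energyDensityChange (h : IsProfile m α κ a f) (hT : 0 < T t) :
    1 / 2 * ∫ x, energyDensityChange (selfSimilar T f) (cone a) t x
      = T t * ∫ y in Ioi 0, (profileDeriv 1 f y ^ 2 - a ^ 2) := by
  rw [integral_congr_ae (h.energyDensityChange_ae_eq hT),
    integral_comp_abs_div (fun y => profileDeriv 1 f y ^ 2 - a ^ 2) hT]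
  ring

theorem exists_energyDensityChange_bounds (h : IsProfile m α κ a f) (hm : 0 < m) (hm4 : m ≤ 4)
    (hα : 0 < α) (T : ℝ → ℝ) :
    ∃ d₀ D₀ : ℝ, 0 < d₀ ∧ 0 < D₀ ∧ ∀ t, 0 < T t →
      Integrable (energyDensityChange (selfSimilar T f) (cone a) t) ∧
      -T t * d₀ < 1 / 2 * ∫ x, energyDensityChange (selfSimilar T f) (cone a) t x ∧
      1 / 2 * ∫ x, energyDensityChange (selfSimilar T f) (cone a) t x ≤ -T t * D₀ := by
  have hneg := h.integral_profileDeriv_one_sq_sub_neg hm hm4 hα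
  set E := ∫ y in Ioi 0, (profileDeriv 1 f y ^ 2 - a ^ 2)
  refine ⟨-E + 1, -E, by linarith, by linarith, fun t hT =>
    ⟨h.integrable_energyDensityChange hm hm4 hα hT, ?_, ?_⟩⟩ <;>
  · rw [h.half_integral_energyDensityChange hT]
    linarith

theorem dissipationDensity_ae_eq (h : IsProfile m α κ a f) (hm : 0 < m) (hα : 0 < α)
    (hT : 0 < T t) :
    (fun x => selfSimilar T f x t ^ m * iteratedDeriv 3 (fun z => selfSimilar T f z t) x ^ 2)
      =ᵐ[volume] fun x => T t ^ m / T t ^ 4 * profileDissipation m f (|x| / T t) := by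
  filter_upwards [Measure.ae_ne volume 0] with x hx
  rw [h.iteratedDeriv_three_selfSimilar_sq hT hx, selfSimilar, profileDissipation,
    Real.mul_rpow hT.le (h.pos hm hα (by positivity)).le]
  ring

theorem dissipationRate_selfSimilar (h : IsProfile m α κ a f) (hm : 0 < m) (hα : 0 < α)
    (hT : 0 < T t) :
    dissipationRate m (selfSimilar T f) t
      = ENNReal.ofReal (2 * (∫ y in Ioi 0, profileDissipation m f y) * T t ^ (m - 3)) := by
  have hint := (integrable_comp_abs_div (h.integrableOn_profileDissipation hm hα) hT).const_mul
    (T t ^ m / T t ^ 4)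
  have hnonneg : ∀ x, 0 ≤ T t ^ m / T t ^ 4 * profileDissipation m f (|x| / T t) := fun x =>
    mul_nonneg (by positivity) (h.profileDissipation_nonneg hm hα (by positivity))
  rw [dissipationRate, lintegral_congr_ae ((h.dissipationDensity_ae_eq hm hα hT).mono
      fun x hx => congrArg ENNReal.ofReal hx),
    ← ofReal_integral_eq_lintegral_ofReal hint (.of_forall hnonneg), integral_const_mul,
    integral_comp_abs_div (profileDissipation m f) hT, show m - 3 = m - (3 : ℕ) by norm_num,
    Real.rpow_sub_natCast hT.ne']
  congr 1
  field_simp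

theorem dissipationRate_selfSimilar_mem_Ioo (h : IsProfile m α κ a f) (hm : 0 < m) (hα : 0 < α)
    (hT : 0 < T t) : dissipationRate m (selfSimilar T f) t ∈ Ioo 0 ⊤ := by
  rw [h.dissipationRate_selfSimilar hm hα hT]
  have := h.integral_profileDissipation_pos hm hα
  exact ⟨ENNReal.ofReal_pos.2 (by positivity), ENNReal.ofReal_lt_top⟩

theorem setLIntegral_dissipationRate_mem_Ioo (h : IsProfile m α κ a f) (hm : 0 < m) (hα : 0 < α)
    {S : Set ℝ} (hS : MeasurableSet S) (hS0 : volume S ≠ 0) (hT : ∀ s ∈ S, 0 < T s)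
    (hint : IntegrableOn (fun s => T s ^ (m - 3)) S) :
    ∫⁻ s in S, dissipationRate m (selfSimilar T f) s ∈ Ioo 0 ⊤ := by
  have hrate : EqOn (dissipationRate m (selfSimilar T f)) (fun s => ENNReal.ofReal
      (2 * (∫ y in Ioi 0, profileDissipation m f y) * T s ^ (m - 3))) S :=
    fun s hs => h.dissipationRate_selfSimilar hm hα (hT s hs)
  have hint' := hint.const_mul (2 * ∫ y in Ioi 0, profileDissipation m f y)
  rw [setLIntegral_congr_fun hS hrate]
  refine ⟨pos_iff_ne_zero.2 fun hzero => hS0 ?_, hint'.lintegral_lt_top⟩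
  rw [lintegral_eq_zero_iff' hint'.aemeasurable.ennreal_ofReal] at hzero
  have hfalse : ∀ᵐ _ ∂volume.restrict S, False := by
    filter_upwards [hzero, ae_restrict_mem hS] with s hs hsS
    have := h.integral_profileDissipation_pos hm hα
    have := hT s hsS
    exact (ENNReal.ofReal_pos.2 (by positivity)).ne' hs
  simpa using hfalse

end IsProfile

theorem integrableOn_Ioo_rpow_rpow {β γ : ℝ} (hβγ : -1 < β * γ) (t : ℝ) :
    IntegrableOn (fun s : ℝ => (s ^ β) ^ γ) (Ioo 0 t) :=
  ((intervalIntegral.intervalIntegrable_rpow' hβγ).1.mono_set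
    Ioo_subset_Ioc_self).congr_fun (fun _ hs => Real.rpow_mul hs.1.le β γ) measurableSet_Ioo

theorem mainTheorem3 :
    (∀ (m κ a : ℝ) (f : ℝ → ℝ), 0 < m → m < 4 →
      IsProfile m (1 / (4 - m)) κ a f →
      (∃ d₀ D₀ : ℝ, 0 < d₀ ∧ 0 < D₀ ∧ ∀ t : ℝ, 0 < t →
        Integrable (energyDensityChange (powerSelfSimilar (1 / (4 - m)) f) (cone a) t) ∧
        -t ^ (1 / (4 - m)) * d₀ < (1 / 2 : ℝ) *
          ∫ x : ℝ, energyDensityChange (powerSelfSimilar (1 / (4 - m)) f) (cone a) t x ∧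
        (1 / 2 : ℝ) *
          ∫ x : ℝ, energyDensityChange (powerSelfSimilar (1 / (4 - m)) f) (cone a) t x
            ≤ -t ^ (1 / (4 - m)) * D₀) ∧
      (∀ t : ℝ, 0 < t →
        (0 < dissipationRate m (powerSelfSimilar (1 / (4 - m)) f) t ∧
          dissipationRate m (powerSelfSimilar (1 / (4 - m)) f) t < ⊤) ∧
        0 < ∫⁻ s in Ioo 0 t, dissipationRate m (powerSelfSimilar (1 / (4 - m)) f) s ∧
        ∫⁻ s in Ioo 0 t, dissipationRate m (powerSelfSimilar (1 / (4 - m)) f) s < ⊤)) ∧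
    (∀ (b κ a : ℝ) (f : ℝ → ℝ), 0 < b →
      IsProfile 4 b κ a f →
      (∃ d₀ D₀ : ℝ, 0 < d₀ ∧ 0 < D₀ ∧ ∀ t : ℝ,
        Integrable (energyDensityChange (expSelfSimilar b f) (cone a) t) ∧
        -Real.exp (b * t) * d₀ < (1 / 2 : ℝ) *
          ∫ x : ℝ, energyDensityChange (expSelfSimilar b f) (cone a) t x ∧
        (1 / 2 : ℝ) * ∫ x : ℝ, energyDensityChange (expSelfSimilar b f) (cone a) t x
            ≤ -Real.exp (b * t) * D₀) ∧
      (∀ t : ℝ,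
        (0 < dissipationRate 4 (expSelfSimilar b f) t ∧
          dissipationRate 4 (expSelfSimilar b f) t < ⊤) ∧
        0 < ∫⁻ s in Iio t, dissipationRate 4 (expSelfSimilar b f) s ∧
        ∫⁻ s in Iio t, dissipationRate 4 (expSelfSimilar b f) s < ⊤)) := by
  constructor
  · intro m κ a f hm hm4 h
    have hα : 0 < 1 / (4 - m) := one_div_pos.2 (by linarith)
    obtain ⟨d₀, D₀, hd₀, hD₀, hbounds⟩ := h.exists_energyDensityChange_bounds hm hm4.le hα
      fun t => t ^ (1 / (4 - m))
    refine ⟨⟨d₀, D₀, hd₀, hD₀, fun t ht => hbounds t (Real.rpow_pos_of_pos ht _)⟩, fun t ht =>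
      ⟨h.dissipationRate_selfSimilar_mem_Ioo (T := fun t => t ^ (1 / (4 - m))) hm hα
        (Real.rpow_pos_of_pos ht _),
      h.setLIntegral_dissipationRate_mem_Ioo (T := fun t => t ^ (1 / (4 - m))) hm hα
        measurableSet_Ioo (by simpa using ht) (fun s hs => Real.rpow_pos_of_pos hs.1 _)
        (integrableOn_Ioo_rpow_rpow ?_ t)⟩⟩
    rw [one_div_mul_eq_div, lt_div_iff₀] <;> linarith
  · intro b κ a f hb h
    obtain ⟨d₀, D₀, hd₀, hD₀, hbounds⟩ := h.exists_energyDensityChange_bounds four_pos le_rfl hb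
      fun t => Real.exp (b * t)
    refine ⟨⟨d₀, D₀, hd₀, hD₀, fun t => hbounds t (Real.exp_pos _)⟩, fun t =>
      ⟨h.dissipationRate_selfSimilar_mem_Ioo (T := fun t => Real.exp (b * t)) four_pos hb
        (Real.exp_pos _),
      h.setLIntegral_dissipationRate_mem_Ioo (T := fun t => Real.exp (b * t)) four_pos hb
        measurableSet_Iio (by simp) (fun s _ => Real.exp_pos _) ?_⟩⟩
    norm_num [(integrableOn_exp_mul_Iic hb t).mono_set Iio_subset_Iic_self]
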